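/- Let $G$ be a finite simple graph with chromatic number $\chi(G)$ and maximum degree $\Delta(G)\ge 6$. Call $G$ critical (that is, vertex-critical) if $\chi(G-v)<\chi(G)$ for every vertex $v$ of $G$, and let $\mathcal{H}(G)$ be the subgraph of $G$ induced on the vertices of degree at least $\chi(G)$. Write $\omega$ for the clique number, with $\omega=0$ for the graph without vertices. Then $G$ is critical and satisfies $\chi(G)\ge\Delta(G)$ and $\omega(\mathcal{H}(G))\le\left\lfloor \Delta(G)/2\right\rfloor-2$ if and only if $G$ is isomorphic to the complete graph $K_{\chi(G)}$. In other words, the complete graphs $K_{\chi(G)}$ are the only critical graphs $G$ with $\chi(G)\ge\Delta(G)\ge 6$ and $\omega(\mathcal{H}(G))\le\left\lfloor \Delta(G)/2\right\rfloor-2$. -/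

import Mathlib

namespace SimpleGraph

/-- `G` is (vertex-)critical: deleting any vertex lowers the chromatic number. -/
def IsVertexCritical {V : Type*} (G : SimpleGraph V) : Prop :=
  ∀ v : V, (G.induce {v}ᶜ).chromaticNumber < G.chromaticNumber

/-- The set of vertices of `G` whose degree is at least the chromatic number of `G`. -/
def highVertices {V : Type*} [Fintype V] (G : SimpleGraph V) [DecidableRel G.Adj] : Set V :=
  {v : V | G.chromaticNumber ≤ (G.degree v : ℕ∞)}

/-- The subgraph `H(G)` of `G` induced on the vertices of degree at least `χ(G)`. -/
abbrev highSubgraph {V : Type*} [Fintype V] (G : SimpleGraph V) [DecidableRel G.Adj] :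
    SimpleGraph G.highVertices :=
  G.induce G.highVertices

end SimpleGraph

/-! Write χ = k + 1. If Δ ≤ k, Brooks' theorem for critical graphs (`adj_trans_of_critical`) gives a
clique on k + 1 vertices. Otherwise Δ = k + 1 and every degree is k (low) or k + 1 (high). In both
cases a clique on k + 1 vertices must be the whole graph, by criticality.

In the second case write k = `r false` + `r true` with nearly equal parts. A k-colouring of G - x is
a partition of V into two sides, with side i `r i`-colourable once x is dropped. Choose x and the
partition with the fewest edges inside the sides away from x, x having exactly `r (τ x)` neighbours
on its own side (`Tight`). The role of x can then be passed to any vertex of its component in its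
side, and a low x may change sides. Each such component is therefore critical and regular of degree
`r (τ x)`: complete if that number is at least 3, by Brooks. The bound on high cliques forces two
adjacent low vertices into each component.

The core is a walk of the uncoloured vertex: move it to a low vertex q of its component, put q on
the other side, repeat. If adjacent low p and q did not see a common opposite component, every
component left behind would carry a mark that forbids a return, so the visited set would grow
forever (`SmallHighCliques.not_visited`). Hence they do see one (`SmallHighCliques.exists_common`).
This makes components complete also for two colours, and joins low vertices completely to the
opposite component. A final exchange of colours joins the high vertices too
(`SmallHighCliques.adj_of_opposite`), and a low x together with its k neighbours is the clique. -/

open Finset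

namespace SimpleGraph

/-! ### Partial colourings: extension and gluing -/

section

variable {V : Type*}

/-- The colouring `c` is proper on the set `S`. -/
def ProperOn {α : Type*} (G : SimpleGraph V) (c : V → α) (S : Set V) : Prop :=
  ∀ u ∈ S, ∀ v ∈ S, G.Adj u v → c u ≠ c v

open Classical in
/-- The neighbours of `v` in the set `S`. -/
noncomputable def nbrsIn [Fintype V] (G : SimpleGraph V) (S : Set V) (v : V) : Finset V :=
  {u | G.Adj v u ∧ u ∈ S}

@[simp] lemma mem_nbrsIn [Fintype V] {G : SimpleGraph V} {S : Set V} {v u : V} :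
    u ∈ G.nbrsIn S v ↔ G.Adj v u ∧ u ∈ S := by
  simp [nbrsIn]

lemma nbrsIn_mono [Fintype V] {G : SimpleGraph V} {S T : Set V} (h : S ⊆ T) (v : V) :
    G.nbrsIn S v ⊆ G.nbrsIn T v := by
  intro u; simp only [mem_nbrsIn]; exact fun hu => ⟨hu.1, h hu.2⟩

variable {G : SimpleGraph V}

lemma ProperOn.mono {α : Type*} {c : V → α} {S T : Set V} (h : G.ProperOn c T) (hST : S ⊆ T) :
    G.ProperOn c S :=
  fun u hu v hv => h u (hST hu) v (hST hv)

open Classical in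
lemma ProperOn.update {α : Type*} {c : V → α} {S : Set V} (h : G.ProperOn c S) {v : V} {a : α}
    (ha : ∀ u ∈ S, G.Adj v u → c u ≠ a) :
    G.ProperOn (Function.update c v a) (insert v S) := by
  intro x hx y hy hxy
  have hne := hxy.ne
  by_cases h1 : x = v
  · subst h1
    have : y ∈ S := by simpa [hne.symm] using hy
    rw [Function.update_self, Function.update_of_ne hne.symm]
    exact (ha y this hxy).symm
  · have hxS : x ∈ S := by simpa [h1] using hx
    by_cases h2 : y = v
    · subst h2
      rw [Function.update_self, Function.update_of_ne h1]
      exact ha x hxS hxy.symm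
    · have hyS : y ∈ S := by simpa [h2] using hy
      rw [Function.update_of_ne h1, Function.update_of_ne h2]
      exact h x hxS y hyS hxy

lemma ProperOn.exists_extend [Fintype V] {k : ℕ} {c : V → Fin k} {S : Set V}
    (h : G.ProperOn c S) {v : V} (hv : v ∉ S) (hk : ((G.nbrsIn S v).image c).card < k) :
    ∃ c' : V → Fin k, (∀ u ∈ S, c' u = c u) ∧ G.ProperOn c' (insert v S) := by
  classical
  obtain ⟨a, ha⟩ : ∃ a, a ∉ (G.nbrsIn S v).image c := by
    by_contra! hcon
    have : (G.nbrsIn S v).image c = univ := eq_univ_of_forall hcon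
    rw [this] at hk; simp at hk
  refine ⟨Function.update c v a, fun u hu => Function.update_of_ne (by rintro rfl; exact hv hu) _ _,
    h.update ?_⟩
  rintro u hu hvu rfl
  exact ha (mem_image_of_mem _ (by simp [hvu, hu]))

/-- Two proper colourings that agree on the overlap of two sets without further edges between
them can be glued. -/
lemma ProperOn.glue {α : Type*} {c d : V → α} {S T : Set V} (hc : G.ProperOn c S)
    (hd : G.ProperOn d T) (hcd : ∀ u ∈ S, u ∈ T → c u = d u)
    (hadj : ∀ u ∈ S, ∀ v ∈ T, G.Adj u v → u ∈ T ∨ v ∈ S) :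
    ∃ e : V → α, G.ProperOn e (S ∪ T) := by
  classical
  refine ⟨fun v => if v ∈ S then c v else d v, ?_⟩
  have key : ∀ u ∈ S, ∀ v ∈ T, v ∉ S → G.Adj u v → c u ≠ d v := by
    intro u hu v hv hvS huv
    rcases hadj u hu v hv huv with h | h
    · rw [hcd u hu h]; exact hd u h v hv huv
    · exact absurd h hvS
  intro u hu v hv huv
  by_cases h1 : u ∈ S <;> by_cases h2 : v ∈ S <;> simp only [h1, h2, if_true, if_false]
  · exact hc u h1 v h2 huv
  · exact key u h1 v (by simpa [h2] using hv) h2 huv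
  · exact (key v h2 u (by simpa [h1] using hu) h1 huv.symm).symm
  · exact hd u (by simpa [h1] using hu) v (by simpa [h2] using hv) huv

lemma ProperOn.comp {α β : Type*} {c : V → α} {S : Set V} (h : G.ProperOn c S) {f : α → β}
    (hf : Function.Injective f) : G.ProperOn (fun v => f (c v)) S :=
  fun u hu v hv huv e => h u hu v hv huv (hf e)

/-- A set `T` around `z`, closed under adjacency inside `A`, along which proper colourings
extend greedily up to `z`. -/
lemma exists_greedy_set [Fintype V] {k : ℕ} {Z A : Set V} (hAZ : A ⊆ Z)
    (hdeg : ∀ v ∈ Z, (G.nbrsIn Z v).card ≤ k) {z : V} (hz : z ∈ A) :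
    ∃ T : Set V, z ∈ T ∧ T ⊆ A ∧ (∀ u ∈ T, ∀ v ∈ A, G.Adj u v → v ∈ T) ∧
      ∀ (S : Set V) (c : V → Fin k), S ⊆ Z → Disjoint S T → G.ProperOn c S →
        ∃ c' : V → Fin k, (∀ u ∈ S, c' u = c u) ∧ G.ProperOn c' (S ∪ (T \ {z})) := by
  classical
  let E : Set V → Prop := fun T => ∀ (S : Set V) (c : V → Fin k), S ⊆ Z → Disjoint S T →
    G.ProperOn c S → ∃ c' : V → Fin k, (∀ u ∈ S, c' u = c u) ∧ G.ProperOn c' (S ∪ (T \ {z}))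
  let F : Set (Set V) := {T | z ∈ T ∧ T ⊆ A ∧ E T}
  have hF : F.Nonempty := by
    refine ⟨{z}, rfl, by simpa using hz, fun S c _ _ hc => ⟨c, fun _ _ => rfl, by simpa using hc⟩⟩
  obtain ⟨T, hT⟩ := (Set.toFinite F).exists_maximal hF
  obtain ⟨⟨hzT, hTA, hE⟩, hmax⟩ := hT
  refine ⟨T, hzT, hTA, ?_, hE⟩
  intro u hu y hy huy
  by_contra hyT
  have hyz : y ≠ z := fun e => hyT (e ▸ hzT)
  have hmem : insert y T ∈ F := by
    refine ⟨Set.mem_insert_of_mem _ hzT, Set.insert_subset hy hTA, ?_⟩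
    intro S c hS hdis hc
    have hyS : y ∉ S := fun h => Set.disjoint_left.mp hdis h (Set.mem_insert _ _)
    have huS : u ∉ S := fun h => Set.disjoint_left.mp hdis h (Set.mem_insert_of_mem _ hu)
    -- `y` is coloured before the rest of `T`, while its neighbour `u` in `T` is still uncoloured,
    -- so a colour is left.
    have hcard : ((G.nbrsIn S y).image c).card < k := by
      refine lt_of_le_of_lt card_image_le (lt_of_lt_of_le (card_lt_card ?_) (hdeg y (hAZ hy)))
      refine ⟨nbrsIn_mono hS y, fun h => huS ?_⟩
      have : u ∈ G.nbrsIn Z y := by simp [huy.symm, hAZ (hTA hu)]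
      simpa [huy.symm] using h this
    obtain ⟨c₁, h1, h2⟩ := hc.exists_extend hyS hcard
    obtain ⟨c₂, h3, h4⟩ := hE (insert y S) c₁ (Set.insert_subset (hAZ hy) hS) (by
      rw [Set.disjoint_left]
      rintro a (rfl | ha) haT
      · exact hyT haT
      · exact Set.disjoint_left.mp hdis ha (Set.mem_insert_of_mem _ haT)) h2
    refine ⟨c₂, fun a ha => (h3 a (Set.mem_insert_of_mem _ ha)).trans (h1 a ha), h4.mono ?_⟩
    rintro a (ha | ⟨rfl | ha, haz⟩)
    · exact Or.inl (Set.mem_insert_of_mem _ ha)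
    · exact Or.inl (Set.mem_insert _ _)
    · exact Or.inr ⟨ha, haz⟩
  exact hyT (hmax hmem (Set.subset_insert _ _) (Set.mem_insert _ _))

end

/-! ### Brooks' theorem for critical sets -/

section

variable {V : Type*} {G : SimpleGraph V}

lemma card_image_lt_of_eq {α β : Type*} [DecidableEq α] [DecidableEq β] {s : Finset α} {f : α → β}
    {a b : α} (ha : a ∈ s) (hb : b ∈ s) (hab : a ≠ b) (h : f a = f b) :
    (s.image f).card < s.card := by
  refine lt_of_le_of_ne card_image_le fun e => hab ?_
  exact (card_image_iff.mp e) ha hb h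

/-- Two colourings can be glued along a non-adjacent pair once a permutation of colours makes them
agree there. -/
lemma exists_perm_map_pair {α : Type*} {a b a' b' : α} (h : a = b ↔ a' = b') :
    ∃ σ : Equiv.Perm α, σ a = a' ∧ σ b = b' := by
  classical
  by_cases hab : a = b
  · subst hab
    exact ⟨Equiv.swap a a', by simp, by simpa using h.mp rfl⟩
  · have hab' : a' ≠ b' := fun e => hab (h.mpr e)
    have h1 : Equiv.swap a a' b ≠ a' := by
      intro e
      exact hab ((Equiv.swap a a').injective (by rw [e]; simp))
    refine ⟨Equiv.swap (Equiv.swap a a' b) b' * Equiv.swap a a', ?_, ?_⟩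
    · simp [Equiv.swap_apply_of_ne_of_ne h1.symm hab']
    · simp

open Classical in
/-- The colours that are not used by `c` on the neighbours of `v` in `S`. -/
noncomputable def freeColors [Fintype V] {k : ℕ} (G : SimpleGraph V) (c : V → Fin k) (S : Set V)
    (v : V) : Finset (Fin k) :=
  univ \ (G.nbrsIn S v).image c

lemma mem_freeColors [Fintype V] {k : ℕ} {c : V → Fin k} {S : Set V} {v : V} {a : Fin k} :
    a ∈ G.freeColors c S v ↔ ∀ u ∈ S, G.Adj v u → c u ≠ a := by
  simp only [freeColors, mem_sdiff, mem_univ, true_and, mem_image, mem_nbrsIn, not_exists, not_and]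
  exact ⟨fun h u hu hvu => h u ⟨hvu, hu⟩, fun h u hu => h u hu.2 hu.1⟩

lemma le_card_freeColors_add [Fintype V] {k : ℕ} (c : V → Fin k) (S : Set V) (v : V) :
    k ≤ (G.freeColors c S v).card + (G.nbrsIn S v).card := by
  classical
  have h1 := le_card_sdiff ((G.nbrsIn S v).image c) (univ : Finset (Fin k))
  have h2 : ((G.nbrsIn S v).image c).card ≤ (G.nbrsIn S v).card := card_image_le
  have h3 : (G.freeColors c S v).card = (univ \ (G.nbrsIn S v).image c).card := by
    simp only [freeColors]
  simp only [card_univ, Fintype.card_fin] at h1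
  omega

lemma ProperOn.exists_recolor_pair [Fintype V] {k : ℕ} {c : V → Fin k} {S : Set V} {v w : V}
    {a b : Fin k} (hc : G.ProperOn c S) (hw : w ∉ S) (hvw : v ≠ w)
    (hadj : ¬ G.Adj v w) (ha : a ∈ G.freeColors c S v) (hb : b ∈ G.freeColors c S w) :
    ∃ d : V → Fin k, G.ProperOn d ({v, w} ∪ S) ∧ d v = a ∧ d w = b := by
  classical
  rw [mem_freeColors] at ha hb
  refine ⟨Function.update (Function.update c w b) v a, ?_, by simp,
    by rw [Function.update_of_ne hvw.symm, Function.update_self]⟩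
  have h1 := (hc.update hb).update (v := v) (a := a) (by
    rintro u (rfl | hu) hvu
    · exact absurd hvu hadj
    · rw [Function.update_of_ne (by rintro rfl; exact hw hu)]
      exact ha u hu hvu)
  rwa [Set.insert_union, Set.singleton_union]

lemma card_nbrsIn_add_le [Fintype V] {S T Z : Set V} (hST : Disjoint S T) (hS : S ⊆ Z)
    (hT : T ⊆ Z) (v : V) :
    (G.nbrsIn S v).card + (G.nbrsIn T v).card ≤ (G.nbrsIn Z v).card := by
  classical
  rw [← card_union_of_disjoint]
  · exact card_le_card (union_subset (nbrsIn_mono hS v) (nbrsIn_mono hT v))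
  · rw [Finset.disjoint_left]
    intro u hu hu'
    exact Set.disjoint_left.mp hST (mem_nbrsIn.mp hu).2 (mem_nbrsIn.mp hu').2

/-- Brooks' theorem for vertex-critical sets: adjacency is transitive on a set `Z` of maximum degree
at most `k ≥ 3` that is not `k`-colourable, but becomes so when any vertex is removed. -/
theorem adj_trans_of_critical [Fintype V] {k : ℕ} (hk : 3 ≤ k) {Z : Set V}
    (hdeg : ∀ v ∈ Z, (G.nbrsIn Z v).card ≤ k) (hnot : ¬ ∃ c : V → Fin k, G.ProperOn c Z)
    (hcrit : ∀ v ∈ Z, ∃ c : V → Fin k, G.ProperOn c (Z \ {v})) {v₁ v₂ v₃ : V} (h1 : v₁ ∈ Z)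
    (h2 : v₂ ∈ Z) (h3 : v₃ ∈ Z) (h12 : G.Adj v₁ v₂) (h23 : G.Adj v₂ v₃) (h13 : v₁ ≠ v₃) :
    G.Adj v₁ v₃ := by
  classical
  by_contra hn
  have hn' : ¬ G.Adj v₃ v₁ := fun h => hn h.symm
  -- `T` contains the component of `v₂` after removal of the non-adjacent pair `v₁`, `v₃`. The
  -- remainder `R` may be nonempty, so no 2-connectivity is needed.
  obtain ⟨T, h2T, hTA, hclosed, hE⟩ := exists_greedy_set (G := G) (Z := Z) (A := Z \ {v₁, v₃})
    Set.sdiff_subset hdeg (z := v₂) ⟨h2, by simp [h12.ne', h23.ne]⟩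
  have hTZ : T ⊆ Z := hTA.trans Set.sdiff_subset
  have h1T : v₁ ∉ T := fun h => (hTA h).2 (by simp)
  have h3T : v₃ ∉ T := fun h => (hTA h).2 (by simp)
  have hPZ : ({v₁, v₃} : Set V) ⊆ Z := by rintro a (rfl | rfl) <;> assumption
  obtain ⟨R, hR⟩ : ∃ R, R = (Z \ {v₁, v₃}) \ T := ⟨_, rfl⟩
  have hRZ : R ⊆ Z := by rw [hR]; exact Set.sdiff_subset.trans Set.sdiff_subset
  have h1R : v₁ ∉ R := by simp [hR]
  have h3R : v₃ ∉ R := by simp [hR]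
  have hTR : Disjoint T R := by rw [hR]; exact Set.disjoint_sdiff_right
  have hZ : Z ⊆ ({v₁, v₃} ∪ T) ∪ ({v₁, v₃} ∪ R) := by
    intro a ha
    by_cases hb : a ∈ ({v₁, v₃} : Set V)
    · exact Or.inl (Or.inl hb)
    by_cases hc : a ∈ T
    · exact Or.inl (Or.inr hc)
    · exact Or.inr (Or.inr (by rw [hR]; exact ⟨⟨ha, hb⟩, hc⟩))
  -- gluing along the pair
  have hglue : ∀ f g : V → Fin k, G.ProperOn f ({v₁, v₃} ∪ T) → G.ProperOn g ({v₁, v₃} ∪ R) →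
      ¬ (f v₁ = f v₃ ↔ g v₁ = g v₃) := by
    intro f g hf hg hfg
    obtain ⟨σ, hσ1, hσ3⟩ := exists_perm_map_pair hfg
    obtain ⟨e, he⟩ := (hf.comp σ.injective).glue hg (by
      rintro u (hu | hu) (hu' | hu')
      · rcases hu with rfl | rfl <;> assumption
      · rcases hu with rfl | rfl <;> assumption
      · rcases hu' with rfl | rfl <;> contradiction
      · exact absurd hu' (Set.disjoint_left.mp hTR hu)) (by
      rintro u (hu | hu) v (hv | hv) huv
      · exact Or.inl (Or.inl hu)
      · exact Or.inl (Or.inl hu)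
      · exact Or.inr (Or.inl hv)
      · rw [hR] at hv
        exact absurd (hclosed u hu v hv.1 huv) hv.2)
    exact hnot ⟨e, he.mono hZ⟩
  -- a colouring of one part in which the pair is monochromatic
  obtain ⟨f, hf, hf13⟩ : ∃ f : V → Fin k, G.ProperOn f ({v₁, v₃} ∪ T) ∧ f v₁ = f v₃ := by
    obtain ⟨f₀, hf₀, hp⟩ := hE {v₁, v₃} (fun _ => ⟨0, by omega⟩) hPZ
      (by rw [Set.disjoint_left]; rintro a (rfl | rfl) <;> assumption)
      (by
        rintro a (rfl | rfl) b (rfl | rfl) hab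
        · exact absurd rfl hab.ne
        · exact absurd hab hn
        · exact absurd hab hn'
        · exact absurd rfl hab.ne)
    have hs : v₂ ∉ ({v₁, v₃} ∪ T \ {v₂} : Set V) := by simp [h12.ne', h23.ne]
    have hsub : ({v₁, v₃} ∪ T \ {v₂} : Set V) ⊆ Z :=
      Set.union_subset hPZ (Set.sdiff_subset.trans hTZ)
    -- `v₂` comes last and has at most `k` neighbours, two of which, `v₁` and `v₃`, share a colour.
    obtain ⟨f, hf, hp'⟩ := hp.exists_extend hs (by
      refine lt_of_lt_of_le (card_image_lt_of_eq (a := v₁) (b := v₃) (by simp [h12.symm])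
        (by simp [h23]) h13 ((hf₀ _ (by simp)).trans (hf₀ _ (by simp)).symm)) ?_
      exact (card_le_card (nbrsIn_mono hsub _)).trans (hdeg v₂ h2))
    refine ⟨f, hp'.mono ?_, ?_⟩
    · rintro a (ha | ha)
      · exact Or.inr (Or.inl ha)
      · by_cases e : a = v₂
        · exact Or.inl e
        · exact Or.inr (Or.inr ⟨ha, e⟩)
    · rw [hf _ (by simp), hf _ (by simp), hf₀ _ (by simp), hf₀ _ (by simp)]
  obtain ⟨g, hg⟩ := hcrit v₂ h2
  replace hg : G.ProperOn g ({v₁, v₃} ∪ R) := hg.mono (by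
    rintro a ha
    refine ⟨?_, ?_⟩
    · rcases ha with ha | ha
      exacts [hPZ ha, hRZ ha]
    · rintro rfl
      rcases ha with (rfl | rfl) | ha
      · exact h12.ne rfl
      · exact h23.ne rfl
      · exact Set.disjoint_left.mp hTR h2T ha)
  have hdiff : ∀ g : V → Fin k, G.ProperOn g ({v₁, v₃} ∪ R) → g v₁ ≠ g v₃ := fun g hg e =>
    hglue f g hf hg (by simp [hf13, e])
  have hdisj : Disjoint (G.freeColors g R v₁) (G.freeColors g R v₃) := by
    rw [Finset.disjoint_left]
    intro a ha hb
    obtain ⟨d, hd, e1, e2⟩ := (hg.mono Set.subset_union_right).exists_recolor_pair h3R h13 hn ha hb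
    exact hdiff d hd (e1.trans e2.symm)
  have hc1 : (G.freeColors g R v₁).card + (G.freeColors g R v₃).card ≤ k := by
    rw [← card_union_of_disjoint hdisj]
    simpa using card_le_univ (G.freeColors g R v₁ ∪ G.freeColors g R v₃)
  have hc2 := le_card_freeColors_add (G := G) g R v₁
  have hc3 := le_card_freeColors_add (G := G) g R v₃
  have hc4 := le_card_freeColors_add (G := G) f T v₁
  have hc5 := le_card_freeColors_add (G := G) f T v₃
  have hc6 := (card_nbrsIn_add_le (G := G) hTR hTZ hRZ v₁).trans (hdeg v₁ h1)
  have hc7 := (card_nbrsIn_add_le (G := G) hTR hTZ hRZ v₃).trans (hdeg v₃ h3)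
  have hm1 : f v₁ ∈ G.freeColors f T v₁ := mem_freeColors.mpr fun u hu h =>
    hf u (Or.inr hu) v₁ (by simp) h.symm
  have hm3 : f v₃ ∈ G.freeColors f T v₃ := mem_freeColors.mpr fun u hu h =>
    hf u (Or.inr hu) v₃ (by simp) h.symm
  -- Disjoint free sets over `R` force the pair to have at least `k` neighbours in `R`, counted with
  -- multiplicity, hence at most `k` in `T`. So at least `k ≥ 3` colours are free over `T` in total,
  -- and the two sets cannot both be the same singleton.
  obtain ⟨a, ha, b, hb, hab⟩ : ∃ a ∈ G.freeColors f T v₁, ∃ b ∈ G.freeColors f T v₃, a ≠ b := by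
    by_contra! hcon
    have e1 : (G.freeColors f T v₁).card ≤ 1 := card_le_one.mpr fun x hx y hy =>
      (hcon x hx _ hm3).trans (hcon y hy _ hm3).symm
    have e3 : (G.freeColors f T v₃).card ≤ 1 := card_le_one.mpr fun x hx y hy =>
      (hcon _ hm1 x hx).symm.trans (hcon _ hm1 y hy)
    omega
  obtain ⟨d, hd, e1, e2⟩ := (hf.mono Set.subset_union_right).exists_recolor_pair h3T h13 hn ha hb
  exact hglue d g hd hg (by simp [e1, e2, hab, hdiff g hg])

end

/-! ### Splittings into two sides and tight uncoloured vertices -/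

section

variable {V : Type*}

/-- `u` and `v` are joined by a path inside `S` all of whose vertices lie on the same side
of `τ`. -/
def Link (G : SimpleGraph V) (τ : V → Bool) (S : Set V) : V → V → Prop :=
  Relation.ReflTransGen fun a b => G.Adj a b ∧ τ a = τ b ∧ a ∈ S ∧ b ∈ S

/-- The component of `x` in the subgraph of the edges inside the two sides of `τ`. -/
def sideComp (G : SimpleGraph V) (τ : V → Bool) (x : V) : Set V :=
  {y | G.Link τ Set.univ x y}

variable {G : SimpleGraph V} {τ σ : V → Bool} {S T : Set V} {u v w x y : V} {r : Bool → ℕ}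

lemma Link.symm (h : G.Link τ S u v) : G.Link τ S v u := by
  induction h with
  | refl => exact .refl
  | tail _ h ih => exact .head ⟨h.1.symm, h.2.1.symm, h.2.2.2, h.2.2.1⟩ ih

lemma Link.trans (h : G.Link τ S u v) (h' : G.Link τ S v w) : G.Link τ S u w :=
  Relation.ReflTransGen.trans h h'

lemma Link.of_adj (h : G.Adj u v) (hτ : τ u = τ v) (hu : u ∈ S) (hv : v ∈ S) :
    G.Link τ S u v :=
  Relation.ReflTransGen.single ⟨h, hτ, hu, hv⟩

lemma Link.mono (h : G.Link τ S u v) (hST : S ⊆ T) (hτ : ∀ a ∈ S, σ a = τ a) :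
    G.Link σ T u v := by
  induction h with
  | refl => exact .refl
  | tail _ h ih => exact .tail ih ⟨h.1, by rw [hτ _ h.2.2.1, hτ _ h.2.2.2, h.2.1], hST h.2.2.1,
      hST h.2.2.2⟩

lemma Link.side_eq (h : G.Link τ S u v) : τ u = τ v := by
  induction h with
  | refl => rfl
  | tail _ h ih => exact ih.trans h.2.1

lemma Link.mem_of_closed {A : Set V} (h : G.Link τ S u v) (hu : u ∈ A)
    (hA : ∀ a ∈ A, ∀ b, G.Adj a b → τ a = τ b → b ∈ A) : v ∈ A := by
  induction h with
  | refl => exact hu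
  | tail _ h ih => exact hA _ ih _ h.1 h.2.1

lemma mem_sideComp_self : x ∈ G.sideComp τ x := Relation.ReflTransGen.refl

lemma sideComp_adj (hy : y ∈ G.sideComp τ x) (h : G.Adj y v) (hτ : τ y = τ v) :
    v ∈ G.sideComp τ x :=
  Link.trans hy (Link.of_adj h hτ trivial trivial)

lemma side_eq_of_mem (hy : y ∈ G.sideComp τ x) : τ y = τ x := (Link.side_eq hy).symm

lemma sideComp_eq (hy : y ∈ G.sideComp τ x) : G.sideComp τ y = G.sideComp τ x := by
  ext z
  exact ⟨fun h => Link.trans hy h, fun h => Link.trans (Link.symm hy) h⟩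

/-- Move `x` to the other side. -/
noncomputable def flipAt (τ : V → Bool) (x : V) : V → Bool :=
  open Classical in Function.update τ x (!τ x)

@[simp] lemma flipAt_self : flipAt τ x x = !τ x := by simp [flipAt]

lemma flipAt_of_ne (h : y ≠ x) : flipAt τ x y = τ y := by simp [flipAt, h]

/-- With `x` removed, side `i` of `τ` is `r i`-colourable. -/
def SplitAt (G : SimpleGraph V) (r : Bool → ℕ) (x : V) (τ : V → Bool) : Prop :=
  ∀ i, ∃ c : V → Fin (r i), G.ProperOn c ({v | τ v = i} \ {x})

open Classical in
lemma SplitAt.update (h : G.SplitAt r x τ) (b : Bool) :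
    G.SplitAt r x (Function.update τ x b) := by
  intro i
  obtain ⟨c, hc⟩ := h i
  refine ⟨c, hc.mono ?_⟩
  rintro a ⟨ha, hax⟩
  refine ⟨?_, hax⟩
  simpa [Function.update_of_ne (show a ≠ x from hax)] using ha

variable [Fintype V]

/-- The neighbours of `v` on the side of `v`. -/
noncomputable abbrev sideNbrs (G : SimpleGraph V) (τ : V → Bool) (v : V) : Finset V :=
  G.nbrsIn {u | τ u = τ v} v

/-- No bipartition has an `r i`-colourable side `i` for both `i`. -/
def NotSplit (G : SimpleGraph V) (r : Bool → ℕ) : Prop :=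
  ∀ τ : V → Bool, ¬ ∀ i, ∃ c : V → Fin (r i), G.ProperOn c {v | τ v = i}

open Classical in
/-- The number of darts inside the sides of `τ` that avoid `x`. -/
noncomputable def splitWeight (G : SimpleGraph V) (x : V) (τ : V → Bool) : ℕ :=
  #{p : V × V | (G.Adj p.1 p.2 ∧ τ p.1 = τ p.2) ∧ p.1 ≠ x ∧ p.2 ≠ x}

/-- `τ` splits `G - x` optimally, and `x` has the least possible number of neighbours on its side. -/
structure Tight (G : SimpleGraph V) (r : Bool → ℕ) (x : V) (τ : V → Bool) : Prop where
  splitAt : G.SplitAt r x τ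
  weight_le : ∀ y σ, G.SplitAt r y σ → G.splitWeight x τ ≤ G.splitWeight y σ
  card_eq : (G.sideNbrs τ x).card = r (τ x)

-- The right-hand side does not mention `x`: for a fixed `τ`, minimal weight means a maximal number
-- of neighbours on the own side.
open Classical in
lemma splitWeight_add (G : SimpleGraph V) (x : V) (τ : V → Bool) :
    G.splitWeight x τ + 2 * (G.sideNbrs τ x).card
      = #{p : V × V | G.Adj p.1 p.2 ∧ τ p.1 = τ p.2} := by
  have h1 : (#{p : V × V | (G.Adj p.1 p.2 ∧ τ p.1 = τ p.2) ∧ p.1 = x}) = (G.sideNbrs τ x).card := by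
    refine card_bij' (fun p _ => p.2) (fun u _ => (x, u)) ?_ ?_ ?_ ?_
    · rintro ⟨a, b⟩ h
      simp only [mem_filter, mem_univ, true_and] at h
      obtain ⟨⟨h1, h2⟩, rfl⟩ := h
      simp [h1, h2]
    · intro u h
      simp only [mem_nbrsIn, Set.mem_ofPred_eq] at h
      simp [h.1, h.2]
    · rintro ⟨a, b⟩ h
      simp only [mem_filter, mem_univ, true_and] at h
      simp [h.2]
    · simp
  have h2 : (#{p : V × V | (G.Adj p.1 p.2 ∧ τ p.1 = τ p.2) ∧ p.2 = x}) = (G.sideNbrs τ x).card := by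
    refine card_bij' (fun p _ => p.1) (fun u _ => (u, x)) ?_ ?_ ?_ ?_
    · rintro ⟨a, b⟩ h
      simp only [mem_filter, mem_univ, true_and] at h
      obtain ⟨⟨h2, h3⟩, rfl⟩ := h
      simp [h2.symm, h3]
    · intro u h
      simp only [mem_nbrsIn, Set.mem_ofPred_eq] at h
      simp [h.1.symm, h.2]
    · rintro ⟨a, b⟩ h
      simp only [mem_filter, mem_univ, true_and] at h
      simp [h.2]
    · simp
  have h3 : univ.filter (fun p : V × V => G.Adj p.1 p.2 ∧ τ p.1 = τ p.2) =
      univ.filter (fun p : V × V => (G.Adj p.1 p.2 ∧ τ p.1 = τ p.2) ∧ p.1 ≠ x ∧ p.2 ≠ x) ∪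
      (univ.filter (fun p : V × V => (G.Adj p.1 p.2 ∧ τ p.1 = τ p.2) ∧ p.1 = x) ∪
        univ.filter (fun p : V × V => (G.Adj p.1 p.2 ∧ τ p.1 = τ p.2) ∧ p.2 = x)) := by
    ext p
    simp only [mem_filter, mem_union, mem_univ, true_and]
    tauto
  rw [h3, card_union_of_disjoint, card_union_of_disjoint, h1, h2, splitWeight]
  · ring
  · rw [Finset.disjoint_left]
    rintro ⟨a, b⟩ h h'
    simp only [mem_filter, mem_univ, true_and] at h h'
    exact h.1.1.ne (h.2.trans h'.2.symm)
  · rw [Finset.disjoint_left]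
    rintro ⟨a, b⟩ h h'
    simp only [mem_filter, mem_union, mem_univ, true_and] at h h'
    tauto

open Classical in
lemma splitWeight_update (b : Bool) :
    G.splitWeight x (Function.update τ x b) = G.splitWeight x τ := by
  unfold splitWeight
  congr 1
  ext p
  simp only [mem_filter, mem_univ, true_and]
  constructor <;> rintro ⟨⟨h1, h2⟩, h3, h4⟩ <;> refine ⟨⟨h1, ?_⟩, h3, h4⟩ <;>
    simpa [Function.update_of_ne h3, Function.update_of_ne h4] using h2

-- A colour missing around `x` could be given to `x`, and `τ` would split all of `G`.
open Classical in
lemma SplitAt.le_card_image (hG : G.NotSplit r) (h : G.SplitAt r x τ) {c : V → Fin (r (τ x))}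
    (hc : G.ProperOn c ({v | τ v = τ x} \ {x})) : r (τ x) ≤ ((G.sideNbrs τ x).image c).card := by
  by_contra! hlt
  refine hG τ fun i => ?_
  by_cases hi : i = τ x
  · subst hi
    obtain ⟨d, _, hd⟩ := hc.exists_extend (v := x) (by simp) (by
      refine lt_of_le_of_lt (card_le_card (image_subset_image (nbrsIn_mono Set.sdiff_subset x))) hlt)
    exact ⟨d, hd.mono fun a ha => by by_cases e : a = x <;> simp_all⟩
  · obtain ⟨d, hd⟩ := h i
    refine ⟨d, hd.mono fun a ha => ⟨ha, ?_⟩⟩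
    rintro rfl
    exact hi (Eq.symm ha)

lemma SplitAt.le_card (hG : G.NotSplit r) (h : G.SplitAt r x τ) :
    r (τ x) ≤ (G.sideNbrs τ x).card := by
  classical
  obtain ⟨c, hc⟩ := h (τ x)
  exact (h.le_card_image hG hc).trans card_image_le

/-- Uncolouring `y` leaves a colour for `x`, which has only `r (τ x)` neighbours on its side.
Minimality of the weight bounds the number of side neighbours of `y` by that of `x`;
`SplitAt.le_card` gives the other bound. -/
lemma Tight.of_adj (hG : G.NotSplit r) (h : G.Tight r x τ) (hxy : G.Adj x y) (hτ : τ x = τ y) :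
    G.Tight r y τ := by
  classical
  have hy : G.SplitAt r y τ := by
    intro i
    obtain ⟨c, hc⟩ := h.splitAt i
    by_cases hi : i = τ x
    · subst hi
      have hsub : ({v | τ v = τ x} \ {x, y} : Set V) ⊆ {v | τ v = τ x} \ {x} :=
        Set.sdiff_subset_sdiff_right (by simp)
      obtain ⟨d, _, hd⟩ := (hc.mono hsub).exists_extend (v := x) (by simp) (by
        refine lt_of_le_of_lt card_image_le (lt_of_lt_of_eq (card_lt_card ?_) h.card_eq)
        refine ⟨nbrsIn_mono Set.sdiff_subset x, fun hs => ?_⟩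
        have : y ∈ G.sideNbrs τ x := by simp [hxy, hτ]
        simpa using hs this)
      refine ⟨d, hd.mono ?_⟩
      rintro a ⟨ha, hay⟩
      by_cases e : a = x
      · exact Or.inl e
      · exact Or.inr ⟨ha, by simpa [e] using hay⟩
    · refine ⟨c, hc.mono ?_⟩
      rintro a ⟨ha, -⟩
      refine ⟨ha, ?_⟩
      rintro rfl
      exact hi (Eq.symm ha)
  have h1 := hy.le_card hG
  have h2 := h.weight_le y τ hy
  have h3 := splitWeight_add G x τ
  have h4 := splitWeight_add G y τ
  have h5 := h.card_eq
  rw [hτ] at h5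
  refine ⟨hy, fun z σ hz => ?_, by omega⟩
  have := h.weight_le z σ hz
  omega

lemma Tight.of_mem (hG : G.NotSplit r) (h : G.Tight r x τ) (hy : y ∈ G.sideComp τ x) :
    G.Tight r y τ := by
  induction hy with
  | refl => exact h
  | tail _ h' ih => exact ih.of_adj hG h'.1 h'.2.1

lemma card_sideNbrs_add_flipAt (x : V) (τ : V → Bool) :
    (G.sideNbrs τ x).card + (G.sideNbrs (flipAt τ x) x).card = (G.nbrsIn Set.univ x).card := by
  classical
  rw [← card_union_of_disjoint]
  · congr 1
    ext u
    simp only [mem_union, mem_nbrsIn, Set.mem_ofPred_eq, Set.mem_univ, and_true, flipAt_self]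
    constructor
    · rintro (h | h) <;> exact h.1
    · intro h
      rw [flipAt_of_ne h.ne']
      cases τ u <;> cases τ x <;> simp [h]
  · rw [Finset.disjoint_left]
    intro u h h'
    simp only [mem_nbrsIn, Set.mem_ofPred_eq, flipAt_self] at h h'
    rw [flipAt_of_ne h.1.ne'] at h'
    rw [h.2] at h'
    simp at h'

/-- The weight ignores edges at `x`, so flipping `x` preserves it; the degree of `x` leaves exactly
the right number of neighbours on the other side. -/
lemma Tight.flip (hG : G.NotSplit r) (h : G.Tight r x τ)
    (hx : (G.nbrsIn Set.univ x).card = r false + r true) : G.Tight r x (flipAt τ x) := by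
  classical
  have hs : G.SplitAt r x (flipAt τ x) := h.splitAt.update _
  refine ⟨hs, fun z σ hz => ?_, ?_⟩
  · rw [flipAt, splitWeight_update]; exact h.weight_le z σ hz
  · have h1 := hs.le_card hG
    have h2 := card_sideNbrs_add_flipAt (G := G) x τ
    have h3 := h.card_eq
    rw [flipAt_self] at h1 ⊢
    cases hb : τ x <;> rw [hb] at h1 h3 <;> simp only [Bool.not_false, Bool.not_true] at h1 ⊢ <;>
      omega

/-- At a minimum of the weight, `x` has at least `r i` neighbours on each side `i`. The degree bound
allows an excess of one, so on at least one side the number is exact, and `x` is placed there. -/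
lemma exists_tight (hG : G.NotSplit r) (hsplit : ∃ x τ, G.SplitAt r x τ)
    (hdeg : ∀ x, (G.nbrsIn Set.univ x).card ≤ r false + r true + 1) : ∃ x τ, G.Tight r x τ := by
  classical
  obtain ⟨x₀, τ₀, h₀⟩ := hsplit
  obtain ⟨⟨x, τ⟩, hmem, hmin⟩ := exists_min_image
    ({p : V × (V → Bool) | G.SplitAt r p.1 p.2} : Finset _) (fun p => G.splitWeight p.1 p.2)
    ⟨(x₀, τ₀), by simpa using h₀⟩
  have hs : G.SplitAt r x τ := by simpa using hmem
  have hw : ∀ y σ, G.SplitAt r y σ → G.splitWeight x τ ≤ G.splitWeight y σ := fun y σ hy =>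
    hmin (y, σ) (by simpa using hy)
  have hs' : G.SplitAt r x (flipAt τ x) := hs.update _
  have h1 := hs.le_card hG
  have h1' := hs'.le_card hG
  have h2 := card_sideNbrs_add_flipAt (G := G) x τ
  have h3 := hdeg x
  by_cases e : (G.sideNbrs τ x).card = r (τ x)
  · exact ⟨x, τ, hs, hw, e⟩
  · refine ⟨x, flipAt τ x, hs', fun z σ hz => ?_, ?_⟩
    · rw [flipAt, splitWeight_update]; exact hw z σ hz
    · rw [flipAt_self] at h1' ⊢
      cases hb : τ x <;> rw [hb] at h1 h1' e <;>
        simp only [Bool.not_false, Bool.not_true] at h1' ⊢ <;> omega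

/-- Removing `q` does not disconnect its component. -/
lemma Tight.link_of_mem (hG : G.NotSplit r) {q : V} (h : G.Tight r q τ) {a b : V}
    (ha : a ∈ G.sideComp τ q) (hb : b ∈ G.sideComp τ q) (haq : a ≠ q) (hbq : b ≠ q) :
    G.Link τ (G.sideComp τ q \ {q}) a b := by
  classical
  have key : ∀ u w, G.Adj q u → τ q = τ u → G.Adj q w → τ q = τ w →
      G.Link τ (G.sideComp τ q \ {q}) u w := by
    intro u w hu hτu hw hτw
    by_contra hn
    obtain ⟨c, hc⟩ := h.splitAt (τ q)
    let P : V → Prop := fun y => G.Link τ (G.sideComp τ q \ {q}) u y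
    have huZ : u ∈ G.sideComp τ q := sideComp_adj mem_sideComp_self hu hτu
    have hP : ∀ y, P y → y ∈ G.sideComp τ q := fun y hy =>
      Link.trans huZ (Link.mono hy (Set.subset_univ _) fun _ _ => rfl)
    have hPadj : ∀ y z, P y → y ≠ q → z ≠ q → G.Adj y z → τ y = τ z → P z := by
      intro y z hy hyq hzq hyz hτ
      exact Link.trans hy (Link.of_adj hyz hτ ⟨hP y hy, hyq⟩ ⟨sideComp_adj (hP y hy) hyz hτ, hzq⟩)
    let d : V → Fin (r (τ q)) := fun v => if P v then Equiv.swap (c u) (c w) (c v) else c v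
    have hd : G.ProperOn d ({v | τ v = τ q} \ {q}) := by
      intro y hy z hz hyz
      have hτ : τ y = τ z := hy.1.trans hz.1.symm
      have hcyz := hc y hy z hz hyz
      have hiff : P y ↔ P z := ⟨fun h => hPadj y z h hy.2 hz.2 hyz hτ,
        fun h => hPadj z y h hz.2 hy.2 hyz.symm hτ.symm⟩
      by_cases hPy : P y
      · have hPz := hiff.mp hPy
        simpa [d, hPy, hPz] using hcyz
      · have hPz : ¬ P z := fun h => hPy (hiff.mpr h)
        simpa [d, hPy, hPz] using hcyz
    have hPu : P u := Relation.ReflTransGen.refl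
    have hPw : ¬ P w := hn
    have h1 := h.splitAt.le_card_image hG hd
    have huw : u ≠ w := fun e => hn (e ▸ hPu)
    have h2 := card_image_lt_of_eq (s := G.sideNbrs τ q) (f := d) (a := u) (b := w)
      (by simp [hu, hτu]) (by simp [hw, hτw]) huw (by simp [d, hPu, hPw])
    rw [h.card_eq] at h2
    omega
  have all : ∀ u, G.Adj q u → τ q = τ u → ∀ y ∈ G.sideComp τ q, y = q ∨
      G.Link τ (G.sideComp τ q \ {q}) u y := by
    intro u hu hτu y hy
    induction hy with
    | refl => exact Or.inl rfl
    | @tail y z hy hyz ih =>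
      by_cases hz : z = q
      · exact Or.inl hz
      right
      rcases ih with rfl | ih
      · exact key u z hu hτu hyz.1 hyz.2.1
      · by_cases hyq : y = q
        · subst hyq; exact key u z hu hτu hyz.1 hyz.2.1
        exact Link.trans ih (Link.of_adj hyz.1 hyz.2.1 ⟨hy, hyq⟩
          ⟨sideComp_adj hy hyz.1 hyz.2.1, hz⟩)
  obtain ⟨u, hu, hτu⟩ : ∃ u, G.Adj q u ∧ τ q = τ u := by
    rcases Relation.ReflTransGen.cases_head (show G.Link τ Set.univ q a from ha) with e | ⟨u, hu, _⟩
    · exact absurd e.symm haq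
    · exact ⟨u, hu.1, hu.2.1⟩
  exact Link.trans (Link.symm ((all u hu hτu a ha).resolve_left haq))
    ((all u hu hτu b hb).resolve_left hbq)

end

/-! ### Low vertices and complete components -/

section

variable {V : Type*} [Fintype V] {G : SimpleGraph V} {r : Bool → ℕ} {τ : V → Bool}
  {p q d n t v w x y z : V}

/-- `x` has exactly as many neighbours as there are colours available to `G - x`. -/
def IsLow (G : SimpleGraph V) (r : Bool → ℕ) (x : V) : Prop :=
  (G.nbrsIn Set.univ x).card = r false + r true

/-- `G` cannot be split according to `r`, and the vertices that are not low span small cliques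
only. -/
structure SmallHighCliques (G : SimpleGraph V) (r : Bool → ℕ) : Prop where
  notSplit : G.NotSplit r
  two_le : 2 ≤ r false
  three_le : 3 ≤ r true
  card_le : ∀ s : Finset V, (∀ u ∈ s, ∀ v ∈ s, u ≠ v → G.Adj u v) → (∀ u ∈ s, ¬ G.IsLow r u) →
    s.card + 1 ≤ r false ∧ s.card + 2 ≤ r true

lemma SmallHighCliques.two_le' (hG : G.SmallHighCliques r) (i : Bool) : 2 ≤ r i := by
  cases i
  · exact hG.two_le
  · exact le_of_lt hG.three_le

lemma nbrsIn_sideComp (hy : y ∈ G.sideComp τ x) :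
    G.nbrsIn (G.sideComp τ x) y = G.sideNbrs τ y := by
  ext u
  simp only [mem_nbrsIn, Set.mem_ofPred_eq]
  constructor
  · rintro ⟨h, hu⟩
    exact ⟨h, (side_eq_of_mem hu).trans (side_eq_of_mem hy).symm⟩
  · rintro ⟨h, hu⟩
    exact ⟨h, sideComp_adj hy h hu.symm⟩

/-- The component of the uncoloured vertex cannot be coloured. -/
lemma Tight.not_properOn_sideComp (hG : G.NotSplit r) (h : G.Tight r x τ)
    (c : V → Fin (r (τ x))) : ¬ G.ProperOn c (G.sideComp τ x) := by
  intro hc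
  refine hG τ fun i => ?_
  obtain ⟨d, hd⟩ := h.splitAt i
  by_cases hi : i = τ x
  · subst hi
    obtain ⟨e, he⟩ := hc.glue (hd.mono (S := {v | τ v = τ x} \ G.sideComp τ x) (by
      rintro a ⟨ha, ha'⟩
      exact ⟨ha, by rintro rfl; exact ha' mem_sideComp_self⟩))
      (fun u hu hu' => absurd hu hu'.2) (by
      intro u hu v hv huv
      exact absurd (sideComp_adj hu huv ((side_eq_of_mem hu).trans hv.1.symm)) hv.2)
    refine ⟨e, he.mono fun a ha => ?_⟩
    by_cases ha' : a ∈ G.sideComp τ x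
    · exact Or.inl ha'
    · exact Or.inr ⟨ha, ha'⟩
  · refine ⟨d, hd.mono ?_⟩
    rintro a ha
    exact ⟨ha, by rintro rfl; exact hi (Eq.symm ha)⟩

lemma Tight.adj_of_mem (hG : G.NotSplit r) (h : G.Tight r x τ) (hr : 3 ≤ r (τ x))
    (hy : y ∈ G.sideComp τ x) (hz : z ∈ G.sideComp τ x) (hyz : y ≠ z) : G.Adj y z := by
  have htrans : ∀ a ∈ G.sideComp τ x, ∀ b ∈ G.sideComp τ x, ∀ c ∈ G.sideComp τ x, G.Adj a b →
      G.Adj b c → a ≠ c → G.Adj a c := by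
    intro a ha b hb c hc
    refine adj_trans_of_critical hr (Z := G.sideComp τ x) ?_ ?_ ?_ ha hb hc
    · intro v hv
      rw [nbrsIn_sideComp hv, (h.of_mem hG hv).card_eq, side_eq_of_mem hv]
    · rintro ⟨c, hc⟩
      exact h.not_properOn_sideComp hG c hc
    · intro v hv
      obtain ⟨c, hc⟩ := (h.of_mem hG hv).splitAt (τ x)
      exact ⟨c, hc.mono fun a ha => ⟨side_eq_of_mem ha.1, ha.2⟩⟩
  rw [← sideComp_eq hy] at hz
  have : z = y ∨ G.Adj y z := by
    induction hz with
    | refl => exact Or.inl rfl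
    | @tail b c hb hbc ih =>
      by_cases hc : c = y
      · exact Or.inl hc
      have hb' : b ∈ G.sideComp τ x := by rw [← sideComp_eq hy]; exact hb
      have hc' := sideComp_adj hb' hbc.1 hbc.2.1
      right
      by_cases hby : b = y
      · exact hby ▸ hbc.1
      · exact htrans y hy b hb' c hc' ((ih (fun e => hby e.symm)).resolve_left hby) hbc.1
          (fun e => hc e.symm)
  exact this.resolve_left hyz.symm

/-- A complete component has a low vertex outside any set of one (or two, on the larger side)
vertices. -/
lemma SmallHighCliques.exists_isLow_notMem (hG : G.SmallHighCliques r) (h : G.Tight r x τ)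
    (hZ : ∀ y ∈ G.sideComp τ x, ∀ z ∈ G.sideComp τ x, y ≠ z → G.Adj y z) (F : Finset V)
    (hF : F.card ≤ 1 ∨ τ x = true ∧ F.card ≤ 2) :
    ∃ y ∈ G.sideComp τ x, G.IsLow r y ∧ y ∉ F := by
  classical
  by_contra! hcon
  let s := insert x (G.sideNbrs τ x)
  have hs : s.card = r (τ x) + 1 := by
    rw [card_insert_of_notMem (by simp), h.card_eq]
  have hsZ : ∀ a ∈ s \ F, a ∈ G.sideComp τ x := by
    intro a ha
    rcases mem_insert.mp (mem_sdiff.mp ha).1 with rfl | ha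
    · exact mem_sideComp_self
    · rw [mem_nbrsIn] at ha
      exact sideComp_adj mem_sideComp_self ha.1 (Eq.symm ha.2)
  have h1 := hG.card_le (s \ F) (fun u hu v hv => hZ u (hsZ u hu) v (hsZ v hv))
    (fun u hu hlow => (mem_sdiff.mp hu).2 (hcon u (hsZ u hu) hlow))
  have h2 := le_card_sdiff F s
  cases hb : τ x <;> rw [hb] at hs hF <;> simp at hF <;> omega

/-- The component of an uncoloured vertex contains two adjacent low vertices. -/
lemma SmallHighCliques.exists_adj_isLow (hG : G.SmallHighCliques r) (h : G.Tight r x τ) :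
    ∃ p ∈ G.sideComp τ x, ∃ q ∈ G.sideComp τ x, G.IsLow r p ∧ G.IsLow r q ∧ G.Adj p q := by
  classical
  by_cases hr : 3 ≤ r (τ x)
  · have hZ : ∀ y ∈ G.sideComp τ x, ∀ z ∈ G.sideComp τ x, y ≠ z → G.Adj y z :=
      fun y hy z hz => h.adj_of_mem hG.notSplit hr hy hz
    obtain ⟨p, hp, hpl, -⟩ := hG.exists_isLow_notMem h hZ ∅ (by simp)
    obtain ⟨q, hq, hql, hqp⟩ := hG.exists_isLow_notMem h hZ {p} (by simp)
    exact ⟨p, hp, q, hq, hpl, hql, hZ p hp q hq (by simpa [eq_comm] using hqp)⟩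
  · by_contra! hcon
    have h2 := hG.two_le' (τ x)
    have hτ : τ x = false := by
      by_contra hb
      rw [Bool.not_eq_false] at hb
      rw [hb] at hr
      exact hr hG.three_le
    -- With `r (τ x) = 2`, no two high vertices are adjacent. If no two low ones in the component
    -- were either, low against high would be a 2-colouring of it.
    refine h.not_properOn_sideComp hG.notSplit
      (fun v => if G.IsLow r v then ⟨0, by omega⟩ else ⟨1, by omega⟩) ?_
    intro u hu v hv huv
    by_cases h1 : G.IsLow r u <;> by_cases h2 : G.IsLow r v <;> simp [h1, h2]
    · exact hcon u hu v hv h1 h2 huv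
    · have := (hG.card_le {u, v} (by
        intro a ha b hb hab
        simp only [mem_insert, mem_singleton] at ha hb
        rcases ha with rfl | rfl <;> rcases hb with rfl | rfl
        · exact absurd rfl hab
        · exact huv
        · exact huv.symm
        · exact absurd rfl hab) (by
        intro a ha
        simp only [mem_insert, mem_singleton] at ha
        rcases ha with rfl | rfl <;> assumption)).1
      rw [card_pair huv.ne] at this
      rw [hτ] at hr
      omega

/-- A low vertex `d` in the opposite component of `q` that sees another vertex of the component
of `q` sees all neighbours of `q` there. -/
lemma Tight.adj_of_adj_nbr (hG : G.NotSplit r) (h : G.Tight r q τ) (hq : G.IsLow r q)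
    (hd : d ∈ G.sideComp (flipAt τ q) q) (hdl : G.IsLow r d) (hdq : d ≠ q)
    (hp : p ∈ G.sideComp τ q) (hpq : p ≠ q) (hpd : G.Adj p d) (hn : G.Adj q n)
    (hτn : τ q = τ n) : G.Adj d n := by
  classical
  have hτd : τ d = !τ q := by
    have := side_eq_of_mem hd
    rwa [flipAt_of_ne hdq, flipAt_self] at this
  have hnd : n ≠ d := by rintro rfl; rw [hτd] at hτn; simp at hτn
  have ht := ((h.flip hG hq).of_mem hG hd).flip hG hdl
  have hσd : flipAt (flipAt τ q) d d = τ q := by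
    rw [flipAt_self, flipAt_of_ne hdq, hτd]; simp
  have hσ : ∀ y, τ y = τ q → y ≠ q → flipAt (flipAt τ q) d y = τ y := by
    intro y hy hyq
    rw [flipAt_of_ne (by rintro rfl; rw [hτd] at hy; simp at hy), flipAt_of_ne hyq]
  have hnZ : n ∈ G.sideComp τ q := sideComp_adj mem_sideComp_self hn hτn
  -- Let the uncoloured vertex go from `q`, flipped, to `d`, flipped back. As `q` is not a cut
  -- vertex, `n` lies in the component of `d`, so it must keep its number of side neighbours. It has
  -- lost `q`, hence must have gained `d`.
  have hlink := h.link_of_mem hG hp hnZ hpq hn.ne'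
  have hn' : n ∈ G.sideComp (flipAt (flipAt τ q) d) d := by
    refine Link.trans (Link.of_adj hpd.symm ?_ trivial trivial) (hlink.mono (Set.subset_univ _) ?_)
    · rw [hσd, hσ p (side_eq_of_mem hp) hpq, side_eq_of_mem hp]
    · exact fun a ha => hσ a (side_eq_of_mem ha.1) ha.2
  have h1 := (ht.of_mem hG hn').card_eq
  have h2 := (h.of_mem hG hnZ).card_eq
  rw [hσ n hτn.symm hn.ne'] at h1
  by_contra hdn
  have h3 : G.sideNbrs (flipAt (flipAt τ q) d) n ⊂ G.sideNbrs τ n := by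
    refine ⟨fun u hu => ?_, fun hs => ?_⟩
    · simp only [mem_nbrsIn, Set.mem_ofPred_eq, hσ n hτn.symm hn.ne'] at hu ⊢
      have hud : u ≠ d := by rintro rfl; exact hdn hu.1.symm
      have huq : u ≠ q := by
        rintro rfl
        have := hu.2
        rw [flipAt_of_ne hud, flipAt_self, ← hτn] at this
        simp at this
      rwa [flipAt_of_ne hud, flipAt_of_ne huq] at hu
    · have : q ∈ G.sideNbrs τ n := by simp [hn.symm, hτn]
      have := hs this
      simp only [mem_nbrsIn, Set.mem_ofPred_eq, hσ n hτn.symm hn.ne'] at this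
      rw [flipAt_of_ne hdq.symm, flipAt_self, ← hτn] at this
      simp at this
  have := card_lt_card h3
  omega

/-- If two adjacent low vertices of a component meet the same opposite component, then their
own component is complete. -/
lemma SmallHighCliques.adj_of_common (hG : G.SmallHighCliques r) (h : G.Tight r x τ)
    (hp : p ∈ G.sideComp τ x) (hq : q ∈ G.sideComp τ x) (hpl : G.IsLow r p) (hql : G.IsLow r q)
    (hpq : G.Adj p q) (hpt : G.Adj p t) (ht : t ∈ G.sideComp (flipAt τ q) q) (htq : t ≠ q)
    (hy : y ∈ G.sideComp τ x) (hz : z ∈ G.sideComp τ x) (hyz : y ≠ z) : G.Adj y z := by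
  classical
  by_cases hr : 3 ≤ r (τ x)
  · exact h.adj_of_mem hG.notSplit hr hy hz hyz
  have hτx : τ x = false := by
    by_contra hb
    rw [Bool.not_eq_false] at hb
    rw [hb] at hr
    exact hr hG.three_le
  have hr2 : r false = 2 := by have := hG.two_le; rw [hτx] at hr; omega
  have hτp : τ p = false := (side_eq_of_mem hp).trans hτx
  have hτq : τ q = false := (side_eq_of_mem hq).trans hτx
  have hTp := h.of_mem hG.notSplit hp
  have hTq := h.of_mem hG.notSplit hq
  have hTp' := hTp.flip hG.notSplit hpl
  have hTq' := hTq.flip hG.notSplit hql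
  have hQ : ∀ y ∈ G.sideComp (flipAt τ q) q, ∀ z ∈ G.sideComp (flipAt τ q) q, y ≠ z → G.Adj y z :=
    fun y hy z hz => hTq'.adj_of_mem hG.notSplit (by simp [hτq, hG.three_le]) hy hz
  have hP : ∀ y ∈ G.sideComp (flipAt τ p) p, ∀ z ∈ G.sideComp (flipAt τ p) p, y ≠ z → G.Adj y z :=
    fun y hy z hz => hTp'.adj_of_mem hG.notSplit (by simp [hτp, hG.three_le]) hy hz
  have hside : ∀ y ∈ G.sideComp (flipAt τ q) q, y ≠ q → τ y = true := by
    intro y hy hyq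
    have := side_eq_of_mem hy
    rwa [flipAt_of_ne hyq, flipAt_self, hτq] at this
  obtain ⟨d, hd, hdl, hdq⟩ := hG.exists_isLow_notMem hTq' hQ {q} (by simp)
  rw [mem_singleton] at hdq
  have hτd := hside d hd hdq
  have hτt := hside t ht htq
  have hdp : d ≠ p := by rintro rfl; simp [hτp] at hτd
  have htP : t ∈ G.sideComp (flipAt τ p) p := sideComp_adj mem_sideComp_self hpt (by
    rw [flipAt_self, flipAt_of_ne hpt.ne', hτp, hτt]; rfl)
  have hdP : d ∈ G.sideComp (flipAt τ p) p := by
    by_cases hdt : d = t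
    · exact hdt ▸ htP
    · refine sideComp_adj htP (hQ t ht d hd (Ne.symm hdt)) ?_
      rw [flipAt_of_ne hpt.ne', flipAt_of_ne hdp, hτt, hτd]
  have hdp' : G.Adj p d := hP p mem_sideComp_self d hdP hdp.symm
  have hdq' : G.Adj q d := hQ q mem_sideComp_self d hd (Ne.symm hdq)
  have hcq : (G.sideNbrs τ q).card = 2 := by rw [hTq.card_eq, hτq, hr2]
  have hcp : (G.sideNbrs τ p).card = 2 := by rw [hTp.card_eq, hτp, hr2]
  have hmq : p ∈ G.sideNbrs τ q := by simp [hpq.symm, hτp, hτq]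
  have hmp : q ∈ G.sideNbrs τ p := by simp [hpq, hτp, hτq]
  obtain ⟨n, hn, hnp⟩ := exists_mem_ne (by omega) p (s := G.sideNbrs τ q)
  obtain ⟨m, hm, hmq'⟩ := exists_mem_ne (by omega) q (s := G.sideNbrs τ p)
  have hn' := mem_nbrsIn.mp hn
  have hm' := mem_nbrsIn.mp hm
  have hτn : τ n = false := (show τ n = τ q from hn'.2).trans hτq
  have hτm : τ m = false := (show τ m = τ p from hm'.2).trans hτp
  have hpq' : p ∈ G.sideComp τ q := sideComp_adj mem_sideComp_self hpq.symm (by rw [hτp, hτq])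
  have hqp' : q ∈ G.sideComp τ p := sideComp_adj mem_sideComp_self hpq (by rw [hτp, hτq])
  have hdn : G.Adj d n := hTq.adj_of_adj_nbr hG.notSplit hql hd hdl hdq hpq' hpq.ne hdp' hn'.1
    (by rw [hτq, hτn])
  have hdm : G.Adj d m := hTp.adj_of_adj_nbr hG.notSplit hpl hdP hdl hdp hqp' hpq.ne' hdq' hm'.1
    (by rw [hτp, hτm])
  have hTd := ((hTq'.of_mem hG.notSplit hd).flip hG.notSplit hdl).card_eq
  have hσd : flipAt (flipAt τ q) d d = false := by
    rw [flipAt_self, flipAt_of_ne hdq, hτd]; rfl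
  have hσ : ∀ y, τ y = false → y ≠ q → flipAt (flipAt τ q) d y = false := by
    intro y hy hyq
    rw [flipAt_of_ne (by rintro rfl; simp [hτd] at hy), flipAt_of_ne hyq, hy]
  -- Once `d` has replaced `q` on the two-coloured side, it has exactly two neighbours there. All of
  -- `p`, `n`, `m` are among them, so `m = n`, and `p`, `q`, `m` form a triangle that is the whole
  -- component.
  have hmn : m = n := by
    by_contra hmn
    have hsub : ({p, n, m} : Finset V) ⊆ G.sideNbrs (flipAt (flipAt τ q) d) d := by
      intro a ha
      simp only [mem_insert, mem_singleton] at ha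
      rw [mem_nbrsIn, Set.mem_ofPred_eq, hσd]
      rcases ha with rfl | rfl | rfl
      · exact ⟨hdp'.symm, hσ _ hτp hpq.ne⟩
      · exact ⟨hdn, hσ _ hτn hn'.1.ne'⟩
      · exact ⟨hdm, hσ _ hτm hmq'⟩
    have := card_le_card hsub
    rw [card_eq_three.mpr ⟨p, n, m, hnp.symm, hm'.1.ne, Ne.symm hmn, rfl⟩, hTd, hσd, hr2] at this
    omega
  subst hmn
  have hTn := hTq.of_mem hG.notSplit (sideComp_adj mem_sideComp_self hn'.1 (by rw [hτq, hτn]))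
  have hcn : (G.sideNbrs τ m).card = 2 := by rw [hTn.card_eq, hτn, hr2]
  have eq_pair : ∀ {s : Finset V} {a b : V}, s.card = 2 → a ∈ s → b ∈ s → a ≠ b →
      ∀ e ∈ s, e = a ∨ e = b := by
    intro s a b hs ha hb hab e he
    have : ({a, b} : Finset V) = s := eq_of_subset_of_card_le (by
      intro e he
      simp only [mem_insert, mem_singleton] at he
      rcases he with rfl | rfl <;> assumption) (by rw [hs, card_pair hab])
    rw [← this] at he
    simpa using he
  have hsubset : ∀ y ∈ G.sideComp τ x, y = p ∨ y = q ∨ y = m := by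
    intro y hy
    rw [← sideComp_eq hp] at hy
    refine Link.mem_of_closed (A := {y | y = p ∨ y = q ∨ y = m}) hy (Or.inl rfl) ?_
    rintro a (rfl | rfl | rfl) b hab hτ
    · rcases eq_pair hcp hmp hm hmq'.symm b (by simp [hab, hτ]) with rfl | rfl <;> simp
    · rcases eq_pair hcq hmq hn hnp.symm b (by simp [hab, hτ]) with rfl | rfl <;> simp
    · rcases eq_pair (a := p) (b := q) hcn (by simp [hm'.1.symm, hτp, hτm])
        (by simp [hn'.1.symm, hτq, hτm]) hpq.ne b (by simp [hab, hτ]) with rfl | rfl <;> simp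
  rcases hsubset y hy with rfl | rfl | rfl <;> rcases hsubset z hz with rfl | rfl | rfl
  all_goals first | exact absurd rfl hyz | skip
  · exact hpq
  · exact hm'.1
  · exact hpq.symm
  · exact hn'.1
  · exact hm'.1.symm
  · exact hn'.1.symm

/-- The pair along which the search for a contradiction proceeds from `x`. -/
lemma SmallHighCliques.exists_pair (hG : G.SmallHighCliques r) (h : G.Tight r x τ)
    (hx : G.IsLow r x) :
    ∃ p ∈ G.sideComp τ x, ∃ q ∈ G.sideComp τ x, G.IsLow r p ∧ G.IsLow r q ∧ G.Adj p q ∧ q ≠ x ∧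
      (p = x ∨ ∀ t, G.Adj p t → t ∈ G.sideComp (flipAt τ q) q → t = q) := by
  by_cases hex : ∃ q ∈ G.sideComp τ x, G.IsLow r q ∧ G.Adj x q
  · obtain ⟨q, hq, hql, hxq⟩ := hex
    exact ⟨x, mem_sideComp_self, q, hq, hx, hql, hxq, hxq.ne', Or.inl rfl⟩
  · push Not at hex
    obtain ⟨p, hp, q, hq, hpl, hql, hpq⟩ := hG.exists_adj_isLow h
    have hqx : q ≠ x := by rintro rfl; exact hex p hp hpl hpq.symm
    have hpx : p ≠ x := by rintro rfl; exact hex q hq hql hpq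
    refine ⟨p, hp, q, hq, hpl, hql, hpq, hqx, Or.inr fun t hpt ht => ?_⟩
    by_contra htq
    exact hex q hq hql
      (hG.adj_of_common h hp hq hpl hql hpq hpt ht htq mem_sideComp_self hq hqx.symm)

end

/-! ### The walk of the uncoloured vertex -/

section

variable {V : Type*} [Fintype V] {G : SimpleGraph V} {r : Bool → ℕ} {τ : V → Bool} {W : Set V}
  {p q s t u v w x y z : V}

omit [Fintype V] in
lemma Link.inter_side {S : Set V} (h : G.Link τ S u v) :
    G.Link τ (S ∩ {a | τ a = τ u}) u v := by
  induction h with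
  | refl => exact .refl
  | tail h h' ih =>
    have e := Link.side_eq h
    exact .tail ih ⟨h'.1, h'.2.1, ⟨h'.2.2.1, e.symm⟩, ⟨h'.2.2.2, (e.trans h'.2.1).symm⟩⟩

/-- The vertex `v` of the visited set `W` cannot be made the uncoloured vertex. -/
def Blocked (G : SimpleGraph V) (r : Bool → ℕ) (τ : V → Bool) (W : Set V) (v : V) : Prop :=
  ∃ u ∈ W, ∃ u' ∈ W, G.Adj v u ∧ τ u ≠ τ v ∧ G.Link τ W u u' ∧
    (G.nbrsIn {y | y ∈ W ∧ τ y = τ u'} u').card < r (τ u') ∧ ¬ G.Adj u' v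

/-- The vertex `v` of the visited set `W` becomes blocked when the uncoloured vertex moves on
from `x`. -/
def Pending (G : SimpleGraph V) (τ : V → Bool) (W : Set V) (x v : V) : Prop :=
  G.Adj v x ∧ τ v ≠ τ x ∧ ∀ y ∈ G.sideComp τ x, G.Adj v y → y = x ∨ y ∈ W

/-- The uncoloured vertex is `x`, and every component of the set `W` of visited vertices contains a
low vertex that is blocked or pending. -/
structure Visited (G : SimpleGraph V) (r : Bool → ℕ) (x : V) (τ : V → Bool) (W : Set V) :
    Prop where
  tight : G.Tight r x τ
  isLow : G.IsLow r x
  notMem : x ∉ W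
  closed : ∀ w ∈ W, ∀ y, G.Adj w y → τ w = τ y → y ∈ W ∨ y = x
  exists_mark : ∀ w ∈ W, ∃ v ∈ W, G.IsLow r v ∧ G.Link τ W w v ∧
    (G.Blocked r τ W v ∨ G.Pending τ W x v)

/-- The uncoloured vertex does not return to a visited component. -/
lemma Visited.notMem_of_mem (hG : G.NotSplit r) (h : G.Visited r x τ W)
    (hy : y ∈ G.sideComp τ x) : y ∉ W := by
  intro hyW
  obtain ⟨v, -, hvl, hlink, hv⟩ := h.exists_mark y hyW
  have hvx : v ∈ G.sideComp τ x := Link.trans hy (hlink.mono (Set.subset_univ _) fun _ _ => rfl)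
  have hτv := side_eq_of_mem hvx
  rcases hv with ⟨u, hu, u', hu', hvu, hτu, huu', hcard, hadj⟩ | ⟨-, hne, -⟩
  swap
  · exact hne hτv
  have hT := (h.tight.of_mem hG hvx).flip hG hvl
  have hτu' : τ u' = τ u := huu'.side_eq.symm
  have huσ : flipAt τ v u = flipAt τ v v := by
    rw [flipAt_of_ne hvu.ne', flipAt_self]
    cases hb : τ u <;> cases hb' : τ v <;> simp_all
  have hu'Z : u' ∈ G.sideComp (flipAt τ v) v := by
    refine Link.trans (Link.of_adj hvu huσ.symm trivial trivial)
      (huu'.inter_side.mono (Set.subset_univ _) ?_)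
    rintro a ⟨-, ha⟩
    exact flipAt_of_ne (by rintro rfl; exact hτu (Eq.symm ha))
  have hu'v : u' ≠ v := by rintro rfl; exact hτu hτu'.symm
  have h1 := (hT.of_mem hG hu'Z).card_eq
  rw [flipAt_of_ne hu'v] at h1
  -- If `v` were uncoloured and flipped, `u'` would lie in its component and need `r (τ u')` side
  -- neighbours. All of them would be in `W`, since `v` is not adjacent to `u'`, and there are too
  -- few.
  refine absurd (h1 ▸ card_le_card ?_) (not_le.mpr hcard)
  intro b hb
  simp only [mem_nbrsIn, Set.mem_ofPred_eq, flipAt_of_ne hu'v] at hb ⊢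
  have hbv : b ≠ v := by rintro rfl; exact hadj hb.1
  rw [flipAt_of_ne hbv] at hb
  refine ⟨hb.1, (h.closed u' hu' b hb.1 hb.2.symm).resolve_right ?_, hb.2⟩
  rintro rfl
  exact hτu (hτu'.symm.trans (hb.2.symm.trans hτv.symm))

/-- The next step of the walk of the uncoloured vertex. -/
lemma Visited.step (hG : G.SmallHighCliques r) (h : G.Visited r x τ W)
    (hp : p ∈ G.sideComp τ x) (hq : q ∈ G.sideComp τ x) (hpl : G.IsLow r p) (hql : G.IsLow r q)
    (hpq : G.Adj p q) (hqx : q ≠ x)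
    (hpt : ∀ t, G.Adj p t → t ∈ G.sideComp (flipAt τ q) q → t = q ∨ t ∈ W) :
    G.Visited r q (flipAt τ q) (W ∪ (G.sideComp τ x \ {q})) := by
  classical
  have hdisj : ∀ y ∈ G.sideComp τ x, y ∉ W := fun y hy => h.notMem_of_mem hG.notSplit hy
  have hTq := h.tight.of_mem hG.notSplit hq
  have hZ := sideComp_eq hq
  have hqW : q ∉ W ∪ (G.sideComp τ x \ {q}) := by
    rintro (hq' | hq')
    · exact hdisj q hq hq'
    · exact hq'.2 rfl
  have hagree : ∀ a ∈ W ∪ (G.sideComp τ x \ {q}), flipAt τ q a = τ a := fun a ha =>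
    flipAt_of_ne (by rintro rfl; exact hqW ha)
  have hxW : x ∈ W ∪ (G.sideComp τ x \ {q}) := Or.inr ⟨mem_sideComp_self, hqx.symm⟩
  have hτq := side_eq_of_mem hq
  have hlink : ∀ a ∈ G.sideComp τ x, ∀ b ∈ G.sideComp τ x, a ≠ q → b ≠ q →
      G.Link (flipAt τ q) (W ∪ (G.sideComp τ x \ {q})) a b := by
    intro a ha b hb haq hbq
    have := hTq.link_of_mem hG.notSplit (hZ ▸ ha) (hZ ▸ hb) haq hbq
    rw [hZ] at this
    exact this.mono Set.subset_union_right fun c hc => hagree c (Or.inr hc)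
  refine ⟨hTq.flip hG.notSplit hql, hql, hqW, ?_, ?_⟩
  · intro w hw y hwy hτ
    by_cases hyq : y = q
    · exact Or.inr hyq
    left
    rw [hagree w hw, flipAt_of_ne hyq] at hτ
    rcases hw with hw | hw
    · rcases h.closed w hw y hwy hτ with hy | rfl
      · exact Or.inl hy
      · exact hxW
    · exact Or.inr ⟨sideComp_adj hw.1 hwy hτ, hyq⟩
  · rintro w (hw | hw)
    · obtain ⟨v, hv, hvl, hwv, hmark⟩ := h.exists_mark w hw
      refine ⟨v, Or.inl hv, hvl, hwv.mono Set.subset_union_left fun a ha => hagree a (Or.inl ha),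
        Or.inl ?_⟩
      rcases hmark with ⟨u, hu, u', hu', hvu, hτu, huu', hcard, hadj⟩ | ⟨hvx, hτv, hvy⟩
      · refine ⟨u, Or.inl hu, u', Or.inl hu', hvu, ?_,
          huu'.mono Set.subset_union_left fun a ha => hagree a (Or.inl ha), ?_, hadj⟩
        · rwa [hagree u (Or.inl hu), hagree v (Or.inl hv)]
        · rw [hagree u' (Or.inl hu')]
          refine lt_of_le_of_lt (card_le_card ?_) hcard
          intro y hy
          simp only [mem_nbrsIn, Set.mem_ofPred_eq] at hy ⊢
          obtain ⟨h1, h2, h3⟩ := hy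
          rw [hagree y h2] at h3
          refine ⟨h1, (h.closed u' hu' y h1 h3.symm).resolve_right ?_, h3⟩
          rintro rfl
          exact hdisj u' (sideComp_adj mem_sideComp_self h1.symm h3) hu'
      -- A pending `v` becomes blocked, with `x` as `u`. A neighbour `u' ≠ x` of `q` has just lost
      -- `q` and is still linked to `x`, because `q` is not a cut vertex; pendency excludes an edge
      -- from `u'` to `v`.
      · have h2 : 1 < (G.sideNbrs τ q).card := by
          rw [hTq.card_eq]; exact hG.two_le' _
        obtain ⟨u', hu', hu'x⟩ := exists_mem_ne h2 x
        rw [mem_nbrsIn, Set.mem_ofPred_eq] at hu'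
        have hu'Z : u' ∈ G.sideComp τ x := sideComp_adj hq hu'.1 hu'.2.symm
        have hu'W : u' ∈ W ∪ (G.sideComp τ x \ {q}) := Or.inr ⟨hu'Z, hu'.1.ne'⟩
        refine ⟨x, hxW, u', hu'W, hvx, ?_,
          hlink x mem_sideComp_self u' hu'Z hqx.symm hu'.1.ne', ?_, ?_⟩
        · rw [hagree x hxW, hagree v (Or.inl hv)]; exact hτv.symm
        · rw [hagree u' hu'W, ← (hTq.of_mem hG.notSplit (hZ ▸ hu'Z)).card_eq]
          refine card_lt_card ⟨fun y hy => ?_, fun hs => ?_⟩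
          · simp only [mem_nbrsIn, Set.mem_ofPred_eq] at hy ⊢
            rw [hagree y hy.2.1] at hy
            exact ⟨hy.1, hy.2.2⟩
          · have : q ∈ G.sideNbrs τ u' := by simp [hu'.1.symm, hu'.2]
            exact hqW (mem_nbrsIn.mp (hs this)).2.1
        · intro hadj
          rcases hvy u' hu'Z hadj.symm with e | e
          · exact hu'x e
          · exact hdisj u' hu'Z e
    -- The component just left is marked by `p`, pending with respect to the new uncoloured vertex
    -- `q`.
    · refine ⟨p, Or.inr ⟨hp, hpq.ne⟩, hpl, hlink w hw.1 p hp hw.2 hpq.ne, Or.inr ⟨hpq, ?_, ?_⟩⟩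
      · rw [flipAt_of_ne hpq.ne, flipAt_self, side_eq_of_mem hp, hτq]
        simp
      · intro y hy hpy
        rcases hpt y hpy hy with e | e
        · exact Or.inl e
        · exact Or.inr (Or.inl e)

/-- The extra condition says that `x` has come from the other side and left its old component in
`W`. It supplies what `Visited.step` needs when `p = x`, and each step restores it. Since a step
adds `x` to `W`, a maximal `W` is impossible. -/
lemma SmallHighCliques.not_visited (hG : G.SmallHighCliques r) (W : Set V) :
    ∀ x τ, G.Visited r x τ W → ¬ ∀ y, G.Adj x y → τ y ≠ τ x → y ∈ W := by
  by_contra hcon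
  push Not at hcon
  let F : Set (Set V) := {W | ∃ x τ, G.Visited r x τ W ∧ ∀ y, G.Adj x y → τ y ≠ τ x → y ∈ W}
  have hF : F.Nonempty := ⟨W, hcon⟩
  obtain ⟨M, ⟨x, τ, hM, hacross⟩, hmax⟩ := (Set.toFinite F).exists_maximal hF
  obtain ⟨p, hp, q, hq, hpl, hql, hpq, hqx, hpt⟩ := hG.exists_pair hM.tight hM.isLow
  have hτq := side_eq_of_mem hq
  have hstep := hM.step hG hp hq hpl hql hpq hqx (by
    intro t hpt' ht
    rcases hpt with rfl | hpt
    · by_cases htq : t = q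
      · exact Or.inl htq
      · refine Or.inr (hacross t hpt' ?_)
        have := side_eq_of_mem ht
        rw [flipAt_self, flipAt_of_ne htq] at this
        rw [this, hτq]
        simp
    · exact Or.inl (hpt t hpt' ht))
  have hle := hmax (y := M ∪ (G.sideComp τ x \ {q})) ⟨q, _, hstep, ?_⟩ Set.subset_union_left
  · exact hM.notMem (hle (Or.inr ⟨mem_sideComp_self, hqx.symm⟩))
  · intro y hqy hy
    rw [flipAt_of_ne hqy.ne', flipAt_self] at hy
    refine Or.inr ⟨sideComp_adj hq hqy ?_, hqy.ne'⟩
    cases hb : τ y <;> cases hb' : τ q <;> simp_all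

/-- Adjacent low vertices of a component meet the same opposite component. -/
lemma SmallHighCliques.exists_common (hG : G.SmallHighCliques r) (h : G.Tight r x τ)
    (hp : p ∈ G.sideComp τ x) (hpl : G.IsLow r p) (hql : G.IsLow r q) (hpq : G.Adj p q)
    (hτ : τ p = τ q) : ∃ t, G.Adj p t ∧ t ∈ G.sideComp (flipAt τ q) q ∧ t ≠ q := by
  by_contra! hcon
  -- The walk starts with nothing visited. The assumed failure lets its first step, from `p` to `q`,
  -- go through.
  have h0 : G.Visited r p τ ∅ :=
    ⟨h.of_mem hG.notSplit hp, hpl, by simp, by simp, by simp⟩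
  have hq : q ∈ G.sideComp τ p := sideComp_adj mem_sideComp_self hpq hτ
  have h1 := h0.step hG mem_sideComp_self hq hpl hql hpq hpq.ne'
    (fun t ht ht' => Or.inl (hcon t ht ht'))
  refine hG.not_visited _ _ _ h1 ?_
  intro y hqy hy
  rw [flipAt_of_ne hqy.ne', flipAt_self] at hy
  refine Or.inr ⟨sideComp_adj hq hqy ?_, hqy.ne'⟩
  cases hb : τ y <;> cases hb' : τ q <;> simp_all

lemma SmallHighCliques.adj_of_mem (hG : G.SmallHighCliques r) (h : G.Tight r x τ)
    (hy : y ∈ G.sideComp τ x) (hz : z ∈ G.sideComp τ x) (hyz : y ≠ z) : G.Adj y z := by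
  obtain ⟨p, hp, q, hq, hpl, hql, hpq⟩ := hG.exists_adj_isLow h
  obtain ⟨t, hpt, ht, htq⟩ := hG.exists_common h hp hpl hql hpq
    ((side_eq_of_mem hp).trans (side_eq_of_mem hq).symm)
  exact hG.adj_of_common h hp hq hpl hql hpq hpt ht htq hy hz hyz

/-- The opposite component of `q` stays connected without `q`, and `p` sees a vertex `t ≠ q` of it.
So `s` lies in the opposite component of `p`, which is complete. -/
lemma SmallHighCliques.adj_opposite (hG : G.SmallHighCliques r) (h : G.Tight r q τ)
    (hp : p ∈ G.sideComp τ q) (hpl : G.IsLow r p) (hql : G.IsLow r q) (hpq : p ≠ q)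
    (hs : s ∈ G.sideComp (flipAt τ q) q) (hsq : s ≠ q) : G.Adj p s := by
  have hadj := hG.adj_of_mem h hp mem_sideComp_self hpq
  have hτp := side_eq_of_mem hp
  obtain ⟨t, hpt, ht, htq⟩ := hG.exists_common h hp hpl hql hadj hτp
  have hopp : ∀ a ∈ G.sideComp (flipAt τ q) q, a ≠ q → τ a = !τ q := by
    intro a ha haq
    have := side_eq_of_mem ha
    rwa [flipAt_self, flipAt_of_ne haq] at this
  have hap : ∀ a ∈ G.sideComp (flipAt τ q) q, a ≠ q → a ≠ p := by
    rintro a ha haq rfl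
    have := hopp a ha haq
    rw [hτp] at this
    simp at this
  have hT := (h.of_mem hG.notSplit hp).flip hG.notSplit hpl
  have htZ : t ∈ G.sideComp (flipAt τ p) p := sideComp_adj mem_sideComp_self hpt (by
    rw [flipAt_self, flipAt_of_ne hpt.ne', hopp t ht htq, hτp])
  have hsZ : s ∈ G.sideComp (flipAt τ p) p := by
    have := (h.flip hG.notSplit hql).link_of_mem hG.notSplit ht hs htq hsq
    refine Link.trans htZ (this.mono (Set.subset_univ _) ?_)
    rintro a ⟨ha, haq⟩
    rw [flipAt_of_ne (hap a ha haq), flipAt_of_ne haq]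
  exact hG.adj_of_mem hT mem_sideComp_self hsZ (hap s hs hsq).symm

end

/-! ### Joining the two components into one clique -/

section

variable {V : Type*} [Fintype V] {G : SimpleGraph V} {r : Bool → ℕ} {τ : V → Bool}
  {x : V}

/-- If `z` and `w` were not adjacent, move `x` to the false side and uncolour `z` on the true side.
Exchanging the colours of `w` and a suitable low `l` would then free the old colour of `l` for `z`.
-/
lemma SmallHighCliques.adj_of_opposite (hG : G.SmallHighCliques r) (h : G.Tight r x τ)
    (hx : G.IsLow r x) (hτx : τ x = true)
    (hdeg : ∀ x, (G.nbrsIn Set.univ x).card ≤ r false + r true + 1) {z w : V}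
    (hz : z ∈ G.sideComp (flipAt τ x) x) (hzx : z ≠ x) (hw : w ∈ G.sideComp τ x) (hwx : w ≠ x) :
    G.Adj z w := by
  classical
  by_contra hzw
  obtain ⟨σ, hσ⟩ : ∃ σ, σ = flipAt (flipAt τ x) z := ⟨_, rfl⟩
  have hclique : ∀ y ∈ G.sideComp τ x, ∀ z ∈ G.sideComp τ x, y ≠ z → G.Adj y z :=
    fun y hy z hz => hG.adj_of_mem h hy hz
  have hlow : ∀ l ∈ G.sideComp τ x, G.IsLow r l → l ≠ x → G.Adj l z := fun l hl hll hlx =>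
    hG.adj_opposite h hl hll hx hlx hz hzx
  have hTz := (h.flip hG.notSplit hx).of_mem hG.notSplit hz
  have hfz : flipAt τ x z = false := by rw [side_eq_of_mem hz, flipAt_self, hτx]; rfl
  have hσz : σ z = true := by rw [hσ, flipAt_self, hfz]; rfl
  have hτz : τ z = false := by rwa [flipAt_of_ne hzx] at hfz
  have hσx : σ x = false := by rw [hσ, flipAt_of_ne hzx.symm, flipAt_self, hτx]; rfl
  have hσy : ∀ y, y ≠ x → y ≠ z → σ y = τ y := fun y h1 h2 => by
    rw [hσ, flipAt_of_ne h2, flipAt_of_ne h1]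
  have hD : ∀ y ∈ G.sideComp τ x, y ≠ x → y ≠ z ∧ σ y = true := by
    intro y hy hyx
    have h1 : τ y = true := (side_eq_of_mem hy).trans hτx
    have h2 : y ≠ z := by rintro rfl; rw [hτz] at h1; simp at h1
    exact ⟨h2, (hσy y hyx h2).trans h1⟩
  have hDadj : ∀ y ∈ G.sideComp τ x, ∀ u, G.Adj y u → σ u = true → u ≠ z → u ∈ G.sideComp τ x := by
    intro y hy u hyu hu huz
    refine sideComp_adj hy hyu ?_
    rw [side_eq_of_mem hy, hτx, ← hσy u (by rintro rfl; simp [hσx] at hu) huz, hu]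
  have hsplit : G.SplitAt r z σ := by rw [hσ]; exact hTz.splitAt.update _
  obtain ⟨c, hc⟩ := hsplit true
  have hN : (G.sideNbrs σ z).card ≤ r true + 1 := by
    have h1 := hdeg z
    have h2 := card_sideNbrs_add_flipAt (G := G) z (flipAt τ x)
    have h3 := hTz.card_eq
    rw [hfz] at h3
    rw [← hσ] at h2
    omega
  have himg : r true ≤ ((G.sideNbrs σ z).image c).card := by
    have key : ∀ i (c : V → Fin (r i)), i = σ z → G.ProperOn c ({v | σ v = i} \ {z}) →
        r i ≤ ((G.sideNbrs σ z).image c).card := by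
      rintro i c rfl hc
      exact hsplit.le_card_image hG.notSplit hc
    exact key true c hσz.symm hc
  obtain ⟨l₁, hl₁, hl₁l, hl₁x⟩ := hG.exists_isLow_notMem h hclique {x} (by simp)
  -- A second low vertex besides `x` and `l₁` needs the stronger clique bound of the true side. At
  -- most `r true + 1` neighbours of `z` carry all `r true` colours, so at most one colour repeats,
  -- and `l₁` or `l₂` escapes it.
  obtain ⟨l₂, hl₂, hl₂l, hl₂x⟩ := hG.exists_isLow_notMem h hclique {x, l₁}
    (Or.inr ⟨hτx, card_le_two⟩)
  simp only [mem_insert, mem_singleton, not_or] at hl₁x hl₂x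
  have hmemN : ∀ l ∈ G.sideComp τ x, G.IsLow r l → l ≠ x → l ∈ G.sideNbrs σ z := by
    intro l hl hll hlx
    simp [(hlow l hl hll hlx).symm, hσz, (hD l hl hlx).2]
  have hproper : ∀ u v, σ u = true → σ v = true → u ≠ z → v ≠ z → G.Adj u v → c u ≠ c v :=
    fun u v hu hv huz hvz => hc u ⟨hu, huz⟩ v ⟨hv, hvz⟩
  -- a low vertex whose colour appears only once around `z`
  obtain ⟨l, hl, hll, hlx, hlu⟩ : ∃ l ∈ G.sideComp τ x, G.IsLow r l ∧ l ≠ x ∧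
      ∀ u ∈ G.sideNbrs σ z, u ≠ l → c u ≠ c l := by
    by_contra! hcon
    obtain ⟨u₁, hu₁, hne₁, hc₁⟩ := hcon l₁ hl₁ hl₁l hl₁x
    obtain ⟨u₂, hu₂, hne₂, hc₂⟩ := hcon l₂ hl₂ hl₂l hl₂x.1
    have h12 : c l₁ ≠ c l₂ := hproper l₁ l₂ (hD l₁ hl₁ hl₁x).2 (hD l₂ hl₂ hl₂x.1).2
      (hD l₁ hl₁ hl₁x).1 (hD l₂ hl₂ hl₂x.1).1 (hclique l₁ hl₁ l₂ hl₂ (Ne.symm hl₂x.2))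
    have hsub : (G.sideNbrs σ z).image c ⊆ ((G.sideNbrs σ z) \ {l₁, l₂}).image c := by
      intro a ha
      obtain ⟨u, hu, rfl⟩ := mem_image.mp ha
      by_cases e1 : u = l₁
      · subst e1
        refine mem_image.mpr ⟨u₁, mem_sdiff.mpr ⟨hu₁, ?_⟩, hc₁⟩
        simp only [mem_insert, mem_singleton, not_or]
        exact ⟨hne₁, by rintro rfl; exact h12 hc₁.symm⟩
      by_cases e2 : u = l₂
      · subst e2
        refine mem_image.mpr ⟨u₂, mem_sdiff.mpr ⟨hu₂, ?_⟩, hc₂⟩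
        simp only [mem_insert, mem_singleton, not_or]
        exact ⟨by rintro rfl; exact h12 hc₂, hne₂⟩
      · exact mem_image_of_mem c (mem_sdiff.mpr ⟨hu, by simp [e1, e2]⟩)
    have h1 := (card_le_card hsub).trans card_image_le
    have h2 : ({l₁, l₂} : Finset V) ⊆ G.sideNbrs σ z := by
      intro a ha
      simp only [mem_insert, mem_singleton] at ha
      rcases ha with rfl | rfl
      · exact hmemN _ hl₁ hl₁l hl₁x
      · exact hmemN _ hl₂ hl₂l hl₂x.1
    rw [card_sdiff_of_subset h2, card_pair (Ne.symm hl₂x.2)] at h1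
    omega
  have hzl := (hlow l hl hll hlx).symm
  have hlw : l ≠ w := by rintro rfl; exact hzw hzl
  obtain ⟨hlz, hσl⟩ := hD l hl hlx
  obtain ⟨hwz, hσw⟩ := hD w hw hwx
  have hclw : c l ≠ c w := hproper l w hσl hσw hlz hwz (hclique l hl w hw hlw)
  -- The exchange is proper: apart from `z`, all neighbours of `l` and `w` on this side lie in the
  -- old component of `x`, which is a clique.
  have hp1 : G.ProperOn c ({v | σ v = true} \ {z, w, l}) :=
    hc.mono (Set.sdiff_subset_sdiff_right (by simp))
  have hp2 := hp1.update (v := w) (a := c l) (by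
    rintro u ⟨hu, hu'⟩ hwu
    simp only [Set.mem_insert_iff, Set.mem_singleton_iff, not_or] at hu'
    exact hproper u l hu hσl hu'.1 hlz
      (hclique u (hDadj w hw u hwu hu hu'.1) l hl hu'.2.2))
  have hp3 := hp2.update (v := l) (a := c w) (by
    rintro u (rfl | ⟨hu, hu'⟩) hlu
    · rw [Function.update_self]; exact hclw
    · simp only [Set.mem_insert_iff, Set.mem_singleton_iff, not_or] at hu'
      rw [Function.update_of_ne hu'.2.1]
      exact hproper u w hu hσw hu'.1 hwz
        (hclique u (hDadj l hl u hlu hu hu'.1) w hw hu'.2.1))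
  have hp4 := hp3.update (v := z) (a := c l) (by
    rintro u (rfl | rfl | ⟨hu, hu'⟩) hzu
    · rw [Function.update_self]; exact hclw.symm
    · exact absurd hzu hzw
    · simp only [Set.mem_insert_iff, Set.mem_singleton_iff, not_or] at hu'
      rw [Function.update_of_ne hu'.2.2, Function.update_of_ne hu'.2.1]
      exact hlu u (by simp [hzu, hσz, show σ u = true from hu]) hu'.2.2)
  refine hG.notSplit σ fun i => ?_
  cases i
  · obtain ⟨d, hd⟩ := hsplit false
    refine ⟨d, hd.mono fun a ha => ⟨ha, ?_⟩⟩
    rintro rfl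
    rw [Set.mem_ofPred_eq, hσz] at ha
    simp at ha
  · refine ⟨_, hp4.mono fun a ha => ?_⟩
    by_cases e1 : a = z
    · exact Or.inl e1
    by_cases e2 : a = l
    · exact Or.inr (Or.inl e2)
    by_cases e3 : a = w
    · exact Or.inr (Or.inr (Or.inl e3))
    · exact Or.inr (Or.inr (Or.inr ⟨ha, by simp [e1, e2, e3]⟩))

/-- A graph that splits after the removal of a vertex, but not itself, and whose high vertices
span small cliques only, contains a clique with one vertex more than there are colours. -/
theorem SmallHighCliques.exists_clique (hG : G.SmallHighCliques r)
    (hsplit : ∃ x τ, G.SplitAt r x τ)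
    (hdeg : ∀ x, (G.nbrsIn Set.univ x).card ≤ r false + r true + 1) :
    ∃ s : Finset V, s.card = r false + r true + 1 ∧ ∀ u ∈ s, ∀ v ∈ s, u ≠ v → G.Adj u v := by
  classical
  obtain ⟨x, τ, h, hx, hτx⟩ : ∃ x τ, G.Tight r x τ ∧ G.IsLow r x ∧ τ x = true := by
    obtain ⟨y, τ, hy⟩ := exists_tight hG.notSplit hsplit hdeg
    obtain ⟨x, hx, -, -, hxl, -⟩ := hG.exists_adj_isLow hy
    have h := hy.of_mem hG.notSplit hx
    cases hb : τ x
    · exact ⟨x, flipAt τ x, h.flip hG.notSplit hxl, hxl, by simp [hb]⟩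
    · exact ⟨x, τ, h, hxl, hb⟩
  have hf := h.flip hG.notSplit hx
  have hmem : ∀ u, G.Adj x u → u ∈ G.sideComp τ x ∨ u ∈ G.sideComp (flipAt τ x) x := by
    intro u hu
    cases hb : τ u
    · refine Or.inr (sideComp_adj mem_sideComp_self hu ?_)
      rw [flipAt_self, flipAt_of_ne hu.ne', hb, hτx]; rfl
    · exact Or.inl (sideComp_adj mem_sideComp_self hu (by rw [hb, hτx]))
  refine ⟨insert x (G.nbrsIn Set.univ x), ?_, ?_⟩
  · rw [card_insert_of_notMem (by simp), hx]
  · intro u hu v hv huv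
    simp only [mem_insert, mem_nbrsIn, Set.mem_univ, and_true] at hu hv
    rcases hu with rfl | hu
    · rcases hv with rfl | hv
      · exact absurd rfl huv
      · exact hv
    · rcases hv with rfl | hv
      · exact hu.symm
      · rcases hmem u hu with hu' | hu' <;> rcases hmem v hv with hv' | hv'
        · exact hG.adj_of_mem h hu' hv' huv
        · exact (hG.adj_of_opposite h hx hτx hdeg hv' hv.ne' hu' hu.ne').symm
        · exact hG.adj_of_opposite h hx hτx hdeg hu' hu.ne' hv' hv.ne'
        · exact hG.adj_of_mem hf hu' hv' huv

end

/-! ### From critical graphs to splittings -/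

section

variable {V : Type*} {G : SimpleGraph V}

lemma colorable_of_properOn {k : ℕ} {c : V → Fin k} (h : G.ProperOn c Set.univ) :
    G.Colorable k :=
  ⟨Coloring.mk c fun {u v} huv => h u trivial v trivial huv⟩

lemma IsVertexCritical.exists_properOn {k : ℕ} (hG : G.IsVertexCritical)
    (hχ : G.chromaticNumber = (k + 1 : ℕ)) (hk : 0 < k) (v : V) :
    ∃ c : V → Fin k, G.ProperOn c (Set.univ \ {v}) := by
  classical
  have h := hG v
  rw [hχ, Nat.cast_add_one, ENat.lt_natCast_add_one_iff, chromaticNumber_le_iff_colorable] at h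
  obtain ⟨C⟩ := h
  refine ⟨fun u => if hu : u ∈ ({v}ᶜ : Set V) then C ⟨u, hu⟩ else ⟨0, hk⟩, ?_⟩
  rintro u ⟨-, hu⟩ w ⟨-, hw⟩ huw
  have hu' : u ∈ ({v}ᶜ : Set V) := hu
  have hw' : w ∈ ({v}ᶜ : Set V) := hw
  simp only [hu', hw', dif_pos]
  exact C.valid (show (G.induce {v}ᶜ).Adj ⟨u, hu'⟩ ⟨w, hw'⟩ from huw)

variable [Fintype V]

lemma card_nbrsIn_univ [DecidableRel G.Adj] (v : V) :
    (G.nbrsIn Set.univ v).card = G.degree v := by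
  rw [← card_neighborFinset_eq_degree]
  congr 1
  ext u
  simp

lemma le_card_nbrsIn_of_properOn {k : ℕ} (hnot : ¬ ∃ c : V → Fin k, G.ProperOn c Set.univ) {v : V}
    (h : ∃ c : V → Fin k, G.ProperOn c (Set.univ \ {v})) : k ≤ (G.nbrsIn Set.univ v).card := by
  classical
  obtain ⟨c, hc⟩ := h
  by_contra! hlt
  obtain ⟨d, -, hd⟩ := hc.exists_extend (v := v) (by simp)
    (card_image_le.trans_lt ((card_le_card (nbrsIn_mono (Set.subset_univ _) v)).trans_lt hlt))
  exact hnot ⟨d, hd.mono fun a _ => by by_cases e : a = v <;> simp [e]⟩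

/-- A critical graph with a clique as large as its chromatic number is complete. -/
lemma eq_univ_of_clique {k : ℕ} (hcrit : ∀ v, ∃ c : V → Fin k, G.ProperOn c (Set.univ \ {v}))
    {s : Finset V} (hs : s.card = k + 1) (hadj : ∀ u ∈ s, ∀ v ∈ s, u ≠ v → G.Adj u v) :
    s = univ := by
  classical
  refine eq_univ_of_forall fun v => ?_
  by_contra hv
  obtain ⟨c, hc⟩ := hcrit v
  have hinj : Set.InjOn c s := by
    intro a ha b hb hab
    by_contra hne
    exact hc a ⟨trivial, by rintro rfl; exact hv ha⟩ b ⟨trivial, by rintro rfl; exact hv hb⟩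
      (hadj a ha b hb hne) hab
  have h1 := card_image_of_injOn hinj
  have h2 := card_le_univ (s.image c)
  rw [Fintype.card_fin] at h2
  omega

omit [Fintype V] in
/-- Colourings with `a + b` colours split into colourings of two sides. -/
lemma ProperOn.exists_split {r : Bool → ℕ} (hr : ∀ i, 0 < r i) {S : Set V}
    {c : V → Fin (r false + r true)} (hc : G.ProperOn c S) :
    ∃ τ : V → Bool, ∀ i, ∃ d : V → Fin (r i), G.ProperOn d ({v | τ v = i} ∩ S) := by
  have he := hc.comp finSumFinEquiv.symm.injective
  refine ⟨fun v => (finSumFinEquiv.symm (c v)).isRight, fun i => ?_⟩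
  cases i
  · refine ⟨fun v => Sum.elim id (fun _ => ⟨0, hr _⟩) (finSumFinEquiv.symm (c v)), ?_⟩
    rintro u ⟨hu, huS⟩ v ⟨hv, hvS⟩ huv
    have := he u huS v hvS huv
    simp only [Set.mem_ofPred_eq] at hu hv
    cases h1 : finSumFinEquiv.symm (c u) <;> cases h2 : finSumFinEquiv.symm (c v) <;> simp_all
  · refine ⟨fun v => Sum.elim (fun _ => ⟨0, hr _⟩) id (finSumFinEquiv.symm (c v)), ?_⟩
    rintro u ⟨hu, huS⟩ v ⟨hv, hvS⟩ huv
    have := he u huS v hvS huv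
    simp only [Set.mem_ofPred_eq] at hu hv
    cases h1 : finSumFinEquiv.symm (c u) <;> cases h2 : finSumFinEquiv.symm (c v) <;> simp_all

omit [Fintype V] in
lemma notSplit_of_not_properOn {r : Bool → ℕ}
    (hnot : ¬ ∃ c : V → Fin (r false + r true), G.ProperOn c Set.univ) : G.NotSplit r := by
  intro τ h
  obtain ⟨c, hc⟩ := h false
  obtain ⟨d, hd⟩ := h true
  refine hnot ⟨fun v => finSumFinEquiv (if τ v then Sum.inr (d v) else Sum.inl (c v)), ?_⟩
  intro u _ v _ huv e
  have e' := finSumFinEquiv.injective e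
  cases hu : τ u <;> cases hv : τ v <;> simp [hu, hv] at e'
  · exact hc u hu v hv huv e'
  · exact hd u hu v hv huv e'

lemma card_le_cliqueNum_highSubgraph [DecidableRel G.Adj] {s : Finset V}
    (hadj : ∀ u ∈ s, ∀ v ∈ s, u ≠ v → G.Adj u v)
    (hs : ∀ u ∈ s, G.chromaticNumber ≤ (G.degree u : ℕ∞)) :
    s.card ≤ G.highSubgraph.cliqueNum := by
  classical
  have h : G.highSubgraph.IsClique (s.subtype (· ∈ G.highVertices)) := by
    rintro ⟨a, ha⟩ ha' ⟨b, hb⟩ hb' hab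
    rw [mem_coe, mem_subtype] at ha' hb'
    exact hadj a ha' b hb' (by simpa using hab)
  have h1 := h.card_le_cliqueNum
  rwa [card_subtype, filter_true_of_mem (fun u hu => show u ∈ G.highVertices from hs u hu)] at h1

/-- A vertex-critical graph of maximum degree `Δ ≥ 6` and chromatic number at least `Δ` whose high
vertices span cliques of at most `⌊Δ / 2⌋ - 2` vertices is complete. -/
theorem IsVertexCritical.adj_of_cliqueNum_le [DecidableRel G.Adj] (hG : G.IsVertexCritical)
    (hΔ : 6 ≤ G.maxDegree) (hχ : (G.maxDegree : ℕ∞) ≤ G.chromaticNumber)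
    (hω : G.highSubgraph.cliqueNum ≤ G.maxDegree / 2 - 2) {u v : V} (huv : u ≠ v) : G.Adj u v := by
  classical
  obtain ⟨m, hm⟩ : ∃ m : ℕ, G.chromaticNumber = m :=
    ENat.ne_top_iff_exists.mp (chromaticNumber_ne_top_iff_exists.mpr ⟨_, G.colorable_of_fintype⟩)
      |>.imp fun _ h => h.symm
  rw [hm, Nat.cast_le] at hχ
  obtain ⟨k, rfl⟩ : ∃ k, m = k + 1 := ⟨m - 1, by omega⟩
  have hcrit := hG.exists_properOn hm (by omega)
  have hnot : ¬ ∃ c : V → Fin k, G.ProperOn c Set.univ := by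
    rintro ⟨c, hc⟩
    have := (colorable_of_properOn hc).chromaticNumber_le
    rw [hm, Nat.cast_le] at this
    omega
  have hmin : ∀ v, k ≤ (G.nbrsIn Set.univ v).card := fun v =>
    le_card_nbrsIn_of_properOn hnot (hcrit v)
  have hmax : ∀ v, (G.nbrsIn Set.univ v).card ≤ G.maxDegree := fun v => by
    rw [card_nbrsIn_univ]; exact G.degree_le_maxDegree v
  obtain ⟨s, hs, hadj⟩ : ∃ s : Finset V, s.card = k + 1 ∧
      ∀ u ∈ s, ∀ v ∈ s, u ≠ v → G.Adj u v := by
    by_cases hk : G.maxDegree ≤ k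
    · have htrans : ∀ a b c, G.Adj a b → G.Adj b c → a ≠ c → G.Adj a c := fun a b c =>
        adj_trans_of_critical (k := k) (by omega) (fun v _ => (hmax v).trans hk) hnot
          (fun v _ => hcrit v) trivial trivial trivial
      refine ⟨insert u (G.nbrsIn Set.univ u), ?_, ?_⟩
      · rw [card_insert_of_notMem (by simp)]
        have := hmin u
        have := hmax u
        omega
      · intro a ha b hb hab
        simp only [mem_insert, mem_nbrsIn, Set.mem_univ, and_true] at ha hb
        rcases ha with rfl | ha <;> rcases hb with rfl | hb
        · exact absurd rfl hab
        · exact hb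
        · exact ha.symm
        · exact htrans a u b ha.symm hb hab
    -- Here Δ = k + 1, so k ≥ 5 and the parts are at least 2 and 3. The larger part is ⌊Δ / 2⌋, two
    -- above the bound on high cliques; the smaller part is at least one above it.
    · obtain ⟨r, hr⟩ : ∃ r : Bool → ℕ, r = fun i => bif i then k - k / 2 else k / 2 := ⟨_, rfl⟩
      have hf : r false = k / 2 := by rw [hr]; rfl
      have ht : r true = k - k / 2 := by rw [hr]; rfl
      obtain rfl : k = r false + r true := by omega
      have hS : G.SmallHighCliques r := by
        refine ⟨notSplit_of_not_properOn hnot, by omega, by omega, fun t hadj hhigh => ?_⟩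
        have := card_le_cliqueNum_highSubgraph hadj (fun a ha => by
          rw [hm, ← card_nbrsIn_univ, Nat.cast_le]
          exact lt_of_le_of_ne (hmin a) (Ne.symm (hhigh a ha)))
        omega
      have hsplit : ∃ x τ, G.SplitAt r x τ := by
        obtain ⟨c, hc⟩ := hcrit u
        obtain ⟨τ, hτ⟩ := hc.exists_split (fun i => lt_of_lt_of_le (by omega) (hS.two_le' i))
        refine ⟨u, τ, fun i => (hτ i).imp fun d hd => hd.mono ?_⟩
        exact fun a ha => ⟨ha.1, trivial, ha.2⟩
      exact hS.exists_clique hsplit fun x => (hmax x).trans hχ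
  rw [eq_univ_of_clique hcrit hs hadj] at hadj
  exact hadj u (mem_univ _) v (mem_univ _) huv

end

end SimpleGraph

theorem theoremM {V : Type*} [Fintype V] (G : SimpleGraph V) [DecidableRel G.Adj]
    (hΔ : 6 ≤ G.maxDegree) :
    (G.IsVertexCritical ∧
        (G.maxDegree : ℕ∞) ≤ G.chromaticNumber ∧
        G.highSubgraph.cliqueNum ≤ G.maxDegree / 2 - 2) ↔
      ∃ n : ℕ, G.chromaticNumber = n ∧ Nonempty (G ≃g SimpleGraph.completeGraph (Fin n)) := by
  classical
  constructor
  · rintro ⟨hG, hχ, hω⟩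
    have htop : G = ⊤ := by
      ext u v
      exact ⟨fun h => h.ne, fun h => hG.adj_of_cliqueNum_le hΔ hχ hω h⟩
    refine ⟨Fintype.card V, ?_, ⟨⟨Fintype.equivFin V, ?_⟩⟩⟩
    · rw [htop, SimpleGraph.chromaticNumber_top]
    · intro u v
      rw [htop]
      simp
  · rintro ⟨n, hn, ⟨φ⟩⟩
    have hcard : Fintype.card V = n := by simpa using Fintype.card_congr φ.toEquiv
    have hne : Nonempty V := by
      by_contra h
      rw [not_nonempty_iff] at h
      simp at hΔ
    have hlt : G.maxDegree < n := hcard ▸ G.maxDegree_lt_card_verts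
    refine ⟨fun v => ?_, ?_, ?_⟩
    · refine ((G.induce {v}ᶜ).colorable_of_fintype.chromaticNumber_le).trans_lt ?_
      rw [hn, Nat.cast_lt, ← hcard]
      exact Fintype.card_subtype_lt (x := v) (by simp)
    · rw [hn, Nat.cast_le]
      exact hlt.le
    · obtain ⟨s, hs⟩ := G.highSubgraph.exists_isNClique_cliqueNum
      -- In a complete graph every degree is below the chromatic number, so there are no high
      -- vertices and the clique number is 0.
      have hempty : s = ∅ := by
        refine Finset.eq_empty_of_forall_notMem ?_
        rintro ⟨a, ha⟩ -
        have ha' : G.chromaticNumber ≤ (G.degree a : ℕ∞) := ha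
        rw [hn, Nat.cast_le] at ha'
        exact absurd (G.degree_le_maxDegree a) (by omega)
      rw [← hs.card_eq, hempty]
      simp
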